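/- Let $m\ge 1$ be an integer. The uniform attachment graph $G^m_n$ is the random loopless multigraph with vertex set $\{1,\dots,n\}$ in which every vertex $j\in\{2,\dots,n\}$ is born with $m$ edges labelled $1,\dots,m$, the other endpoint of each being chosen uniformly at random from $\{1,\dots,j-1\}$, all choices being independent (and the same for all $n$, so that $G^m_1\subseteq G^m_2\subseteq\cdots$); $G^m_\infty:=\bigcup_n G^m_n$. All graphs are loopless multigraphs. A copy of a graph $F$ in a graph $G$ is a subgraph of $G$ isomorphic to $F$. Let $H$ be a finite connected graph that is multicyclic, i.e. contains at least two (not necessarily edge- or vertex-disjoint) cycles, where a pair of parallel edges counts as a cycle of length 2. Let $H'$ be the 2-core of $H$, i.e. the largest subgraph of $H$ with all degrees at least $2$, and suppose that $H$ has exactly one vertex that is not in $H'$; in other words, $H$ is obtained from $H'$ by attaching a single edge ($t=1$). Let $W_n$ and $W'_n$ be the numbers of copies of $H$ and $H'$, respectively, in $G^m_n$, and let $W'_\infty$ be the number of copies of $H'$ in $G^m_\infty$. Let $r$ be the number of vertices $v$ of $H'$ such that attaching to $H'$ an edge at $v$ (leading to a new vertex) yields a graph isomorphic to $H$, and let $c:=rm$.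 Then $c>0$, $W'_\infty<\infty$ almost surely, and, as $n\to\infty$, $$\frac{W_n}{\log n}-c\,W'_n\to 0\quad\text{almost surely, and thus}\quad \frac{W_n}{\log n}\to c\,W'_\infty\quad\text{almost surely.}$$ -/

import Mathlib

open MeasureTheory ProbabilityTheory Filter Topology
open scoped Graph ENNReal

/-!
Graphs are loopless multigraphs: Mathlib's `Graph α β` (vertices in `α`, edges in `β`), with
`K ≤ G` meaning that `K` is a subgraph of `G`.
-/

namespace Graph

variable {α β α' β' : Type*}

/-- Two multigraphs are isomorphic: there are bijections between their vertices and between their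
edges that preserve incidence. -/
def IsIso (G : Graph α β) (H : Graph α' β') : Prop :=
  ∃ (φ : V(G) ≃ V(H)) (ψ : E(G) ≃ E(H)), ∀ (e : E(G)) (x y : V(G)),
    G.IsLink e x y ↔ H.IsLink (ψ e) (φ x) (φ y)

/-- The set of copies of `H` in `G`: the subgraphs of `G` that are isomorphic to `H`. -/
def copies (H : Graph α β) (G : Graph α' β') : Set (Graph α' β') :=
  {K | K ≤ G ∧ IsIso K H}

/-- `G` is connected: it is non-empty and any two vertices are joined by a walk. -/
def IsConnected (G : Graph α β) : Prop :=
  V(G).Nonempty ∧ ∀ x ∈ V(G), ∀ y ∈ V(G), Relation.ReflTransGen G.Adj x y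

/-- The cycle with `ℓ` vertices and `ℓ` edges (for `ℓ ≥ 1`): the edge `e` joins the vertices
`e` and `e + 1`. For `ℓ = 2` it is a pair of parallel edges. -/
def cycle (ℓ : ℕ) : Graph (ZMod ℓ) (ZMod ℓ) where
  vertexSet := Set.univ
  edgeSet := Set.univ
  IsLink e x y := s(x, y) = s(e, e + 1)
  isLink_symm := fun _ _ ↦ ⟨fun _ _ h ↦ Sym2.eq_swap.trans h⟩
  eq_or_eq_of_isLink_of_isLink := by
    intro e x y v w h h'
    have h2 := h.trans h'.symm
    rw [Sym2.eq_iff] at h2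
    tauto
  edge_mem_iff_exists_isLink := fun e ↦ ⟨fun _ ↦ ⟨e, e + 1, rfl⟩, fun _ ↦ Set.mem_univ e⟩
  left_mem_of_isLink := fun _ _ _ _ ↦ Set.mem_univ _

/-- The set of cycles (of all lengths `ℓ ≥ 2`) contained in `G`. -/
def cycles (G : Graph α β) : Set (Graph α β) :=
  {C | ∃ ℓ : ℕ, 2 ≤ ℓ ∧ C ∈ copies (cycle ℓ) G}

/-- `G` is multicyclic: it contains at least two (not necessarily disjoint) cycles. -/
def IsMulticyclic (G : Graph α β) : Prop :=
  2 ≤ G.cycles.encard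

/-- The degree of the vertex `x` in a loopless multigraph: the number of edges incident to it. -/
noncomputable def deg (G : Graph α β) (x : α) : ℕ∞ :=
  (G.incidenceSet x).encard

/-- `H'` is the 2-core of `H`: the largest subgraph of `H` in which all degrees are at least 2. -/
def IsTwoCore (H' H : Graph α β) : Prop :=
  IsGreatest {K : Graph α β | K ≤ H ∧ ∀ x ∈ V(K), 2 ≤ K.deg x} H'

/-- The graph obtained from `G` by adding one new vertex (`none`) and one new edge (`none`), which
joins the new vertex to the vertex `v` of `G`. -/
def attachEdge (G : Graph α β) (v : V(G)) : Graph (Option α) (Option β) where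
  vertexSet := insert none (some '' V(G))
  IsLink e x y :=
    (e = none ∧ s(x, y) = s(none, some (v : α))) ∨
      ∃ e' x' y', e = some e' ∧ x = some x' ∧ y = some y' ∧ G.IsLink e' x' y'
  isLink_symm := by
    rintro e -
    refine ⟨?_⟩
    rintro x y (⟨he, h⟩ | ⟨e', x', y', he, hx, hy, h⟩)
    · exact Or.inl ⟨he, Sym2.eq_swap.trans h⟩
    · exact Or.inr ⟨e', y', x', he, hy, hx, h.symm⟩
  eq_or_eq_of_isLink_of_isLink := by
    rintro e x y p q (⟨he, h⟩ | ⟨e', x', y', he, rfl, rfl, h⟩)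
      (⟨he2, h2⟩ | ⟨e2, x2, y2, he2, rfl, rfl, h2⟩)
    · have h3 := h.trans h2.symm
      rw [Sym2.eq_iff] at h3
      tauto
    · simp [he] at he2
    · simp [he2] at he
    · obtain rfl : e' = e2 := by simpa [he] using he2
      simpa using h.left_eq_or_eq h2
  left_mem_of_isLink := by
    rintro e x y (⟨-, h⟩ | ⟨e', x', y', -, rfl, -, h⟩)
    · rw [Sym2.eq_iff] at h
      rcases h with ⟨rfl, -⟩ | ⟨rfl, -⟩
      · exact Set.mem_insert _ _
      · exact Set.mem_insert_of_mem _ ⟨v, v.2, rfl⟩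
    · exact Set.mem_insert_of_mem _ ⟨x', h.left_mem, rfl⟩

/-- The number of vertices of `H'` such that attaching an edge at that vertex yields a copy
of `H`. -/
noncomputable def attachCount (H' : Graph α β) (H : Graph α' β') : ℕ :=
  {v : V(H') | IsIso (H'.attachEdge v) H}.ncard

end Graph

/-- `U j a` (`j ≥ 2`) is the random end vertex of the `a`th edge born with the vertex `j`: all these
choices are independent, and `U j a` is uniformly distributed on `{1, …, j - 1}`.
(The values `U j a` for `j < 2` play no role.) -/
structure IsUniformAttachment {Ω : Type*} [MeasurableSpace Ω] {m : ℕ}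
    (U : ℕ → Fin m → Ω → ℕ) (μ : Measure Ω) : Prop where
  measurable : ∀ j, 2 ≤ j → ∀ a, Measurable (U j a)
  uniform : ∀ j, 2 ≤ j → ∀ a, ∀ i, 1 ≤ i → i < j →
    μ {ω | U j a ω = i} = 1 / ((j - 1 : ℕ) : ℝ≥0∞)
  indep : iIndepFun (fun p : {j : ℕ // 2 ≤ j} × Fin m ↦ U p.1 p.2) μ

/-- The attachment graph for the choices `f`: its vertices are the positive integers `i ≤ n`
(all positive integers if `n = ⊤`), and for each vertex `j ≥ 2` and each label `a` it
has an edge, named `(j, a)`, between `j` and `f j a`. (Here `1 ≤ f j a < j`; an edge for which this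
fails is left out.) -/
def attachmentGraph {m : ℕ} (f : ℕ → Fin m → ℕ) (n : ℕ∞) : Graph ℕ (ℕ × Fin m) where
  vertexSet := {i | 1 ≤ i ∧ (i : ℕ∞) ≤ n}
  IsLink e x y :=
    2 ≤ e.1 ∧ (e.1 : ℕ∞) ≤ n ∧ (1 ≤ f e.1 e.2 ∧ f e.1 e.2 < e.1) ∧ s(x, y) = s(e.1, f e.1 e.2)
  isLink_symm := fun _ _ ↦ ⟨fun _ _ h ↦ ⟨h.1, h.2.1, h.2.2.1, Sym2.eq_swap.trans h.2.2.2⟩⟩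
  eq_or_eq_of_isLink_of_isLink := by
    rintro e x y v w ⟨-, -, -, h⟩ ⟨-, -, -, h'⟩
    have h2 := h.trans h'.symm
    rw [Sym2.eq_iff] at h2
    tauto
  left_mem_of_isLink := by
    rintro e x y ⟨h1, h2, ⟨h3, h4⟩, h⟩
    rw [Sym2.eq_iff] at h
    rcases h with ⟨rfl, -⟩ | ⟨rfl, -⟩
    · exact ⟨by omega, h2⟩
    · exact ⟨h3, le_trans (by exact_mod_cast h4.le) h2⟩

/-- The number of copies of `H` in the random graph with `m` edges born at each vertex and vertices
`1, …, n` (`n = ⊤`: all positive integers), at the sample point `ω`. For `n = ⊤` it is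
meaningful only if there are finitely many copies. -/
noncomputable def copyCount {α β Ω : Type*} {m : ℕ} (H : Graph α β) (U : ℕ → Fin m → Ω → ℕ)
    (n : ℕ∞) (ω : Ω) : ℕ :=
  (Graph.copies H (attachmentGraph (fun j a ↦ U j a ω) n)).ncard

/-! The single vertex of `H` outside its 2-core is a leaf, so a copy of `H` is a copy of `H'` plus
one pendant edge, and it determines that copy of `H'` as its own 2-core. Hence `W_n` is the sum,
over the copies of `H'`, of the number of edges extending each to a copy of `H`
(`ncard_copies_eq_sum`). Two almost sure facts then suffice.

Finiteness: in a connected multicyclic graph of minimum degree at least 2, every nonempty set of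
vertices touches more edges than it has elements (`card_lt_card_touching`). An embedding `φ` of `H'`
with prescribed edge labels is present with probability at most the product of `2 / max` over its
edges, where `max` is the younger end. Applying the strict inequality to the sets `{φ > t}` bounds
this by a constant times the product of `φ(v) ^ (-(1 + 1/k))` over the `k` vertices
(`prod_two_div_le`). This is summable over `φ`, so Borel–Cantelli leaves finitely many copies of
`H'` (`ae_finite_copies`), and `W'_n` is eventually constant.

Degrees: for fixed `v` and `a`, the number of `j ≤ n` with `U j a = v` is a sum of independent
indicators whose mean is asymptotic to `log n`, and it is almost surely asymptotic to its mean
(`ae_tendsto_card_div_log`). This holds for all `v` and `a` simultaneously, so each copy of `H'`,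
with `r` admissible vertices and `m` labels, has about `r m log n` extensions; summing over the
finitely many copies gives the limit. -/

namespace Graph

/-! ### Isomorphisms, degrees and attaching an edge -/

section Iso

variable {α β α' β' α'' β'' : Type*}

lemma IsIso.symm {G : Graph α β} {H : Graph α' β'} (h : IsIso G H) : IsIso H G := by
  obtain ⟨φ, ψ, h⟩ := h
  exact ⟨φ.symm, ψ.symm, fun e x y ↦ by simp [h]⟩

lemma IsIso.trans {G : Graph α β} {H : Graph α' β'} {K : Graph α'' β''} (h : IsIso G H)
    (h' : IsIso H K) : IsIso G K := by
  obtain ⟨φ, ψ, h⟩ := h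
  obtain ⟨φ', ψ', h'⟩ := h'
  exact ⟨φ.trans φ', ψ.trans ψ', fun e x y ↦ by simp [h, h']⟩

/-- An edge has only one unordered pair of ends, so preservation of incidence in one direction
already gives the converse. -/
lemma isIso_of_isLink_imp {G : Graph α β} {H : Graph α' β'} (φ : V(G) ≃ V(H)) (ψ : E(G) ≃ E(H))
    (h : ∀ (e : E(G)) (x y : V(G)), G.IsLink e x y → H.IsLink (ψ e) (φ x) (φ y)) :
    IsIso G H := by
  refine ⟨φ, ψ, fun e x y ↦ ⟨h e x y, fun h' ↦ ?_⟩⟩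
  obtain ⟨a, b, hab⟩ := exists_isLink_of_mem_edgeSet e.2
  have h2 := h e ⟨a, hab.left_mem⟩ ⟨b, hab.right_mem⟩ hab
  rcases h2.eq_and_eq_or_eq_and_eq h' with ⟨h3, h4⟩ | ⟨h3, h4⟩
  · rw [← φ.injective (Subtype.ext h3), ← φ.injective (Subtype.ext h4)]
    exact hab
  · rw [← φ.injective (Subtype.ext h3), ← φ.injective (Subtype.ext h4)]
    exact hab.symm

lemma two_le_deg_iff {G : Graph α β} {x : α} :
    2 ≤ G.deg x ↔ ∃ e f, e ≠ f ∧ G.Inc e x ∧ G.Inc f x := by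
  have : (2 : ℕ∞) ≤ G.deg x ↔ 1 < G.deg x := by
    rw [← one_add_one_eq_two, ENat.add_one_le_iff (by simp)]
  rw [this, deg, Set.one_lt_encard_iff]
  constructor
  · rintro ⟨a, b, ha, hb, hab⟩
    exact ⟨a, b, hab, ha, hb⟩
  · rintro ⟨a, b, hab, ha, hb⟩
    exact ⟨a, b, ha, hb, hab⟩

lemma two_le_deg_mono {G K : Graph α β} (h : K ≤ G) {x : α} (hx : 2 ≤ K.deg x) :
    2 ≤ G.deg x := by
  rw [two_le_deg_iff] at hx ⊢
  obtain ⟨e, f, hef, he, hf⟩ := hx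
  exact ⟨e, f, hef, he.mono h, hf.mono h⟩

lemma IsIso.two_le_deg {G : Graph α β} {H : Graph α' β'} (h : IsIso G H)
    (hH : ∀ x ∈ V(H), 2 ≤ H.deg x) : ∀ x ∈ V(G), 2 ≤ G.deg x := by
  obtain ⟨φ, ψ, h⟩ := h
  intro x hx
  have key : ∀ e, H.Inc e (φ ⟨x, hx⟩) → ∃ e' : E(G), ψ e' = e ∧ G.Inc e' x := by
    rintro e ⟨y, hy⟩
    refine ⟨ψ.symm ⟨e, hy.edge_mem⟩, by simp, φ.symm ⟨y, hy.right_mem⟩, ?_⟩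
    have := (h (ψ.symm ⟨e, hy.edge_mem⟩) ⟨x, hx⟩ (φ.symm ⟨y, hy.right_mem⟩)).2 (by simpa using hy)
    simpa using this
  obtain ⟨e, f, hef, he, hf⟩ := two_le_deg_iff.1 (hH _ (φ ⟨x, hx⟩).2)
  obtain ⟨e', rfl, he'⟩ := key e he
  obtain ⟨f', rfl, hf'⟩ := key f hf
  exact two_le_deg_iff.2 ⟨e', f', fun hh ↦ hef (by rw [Subtype.ext hh]), he', hf'⟩

/-- The vertices of `G.attachEdge v`. -/
def attachEdgeVertexEquiv (G : Graph α β) (v : V(G)) : V(G.attachEdge v) ≃ Option V(G) where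
  toFun
    | ⟨none, _⟩ => none
    | ⟨some x, h⟩ => some ⟨x, by simpa [attachEdge] using h⟩
  invFun
    | none => ⟨none, by simp [attachEdge]⟩
    | some x => ⟨some x, by simp [attachEdge]⟩
  left_inv := by rintro ⟨_ | x, h⟩ <;> rfl
  right_inv := by rintro (_ | x) <;> rfl

lemma none_mem_edgeSet_attachEdge (G : Graph α β) (v : V(G)) : none ∈ E(G.attachEdge v) :=
  ⟨none, some v, Or.inl ⟨rfl, rfl⟩⟩

lemma some_mem_edgeSet_attachEdge {G : Graph α β} {v : V(G)} {e : β} :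
    some e ∈ E(G.attachEdge v) ↔ e ∈ E(G) := by
  constructor
  · rintro ⟨x, y, ⟨h, -⟩ | ⟨e', x', y', h, -, -, h'⟩⟩
    · simp at h
    · obtain rfl : e = e' := by simpa using h
      exact h'.edge_mem
  · intro h
    obtain ⟨x, y, hxy⟩ := exists_isLink_of_mem_edgeSet h
    exact ⟨some x, some y, Or.inr ⟨e, x, y, rfl, rfl, rfl, hxy⟩⟩

/-- The edges of `G.attachEdge v`. -/
def attachEdgeEdgeEquiv (G : Graph α β) (v : V(G)) : E(G.attachEdge v) ≃ Option E(G) where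
  toFun
    | ⟨none, _⟩ => none
    | ⟨some x, h⟩ => some ⟨x, some_mem_edgeSet_attachEdge.1 h⟩
  invFun
    | none => ⟨none, none_mem_edgeSet_attachEdge G v⟩
    | some x => ⟨some x, some_mem_edgeSet_attachEdge.2 x.2⟩
  left_inv := by rintro ⟨_ | x, h⟩ <;> rfl
  right_inv := by rintro (_ | x) <;> rfl

lemma attachEdge_isIso {G : Graph α β} {H : Graph α' β'} (v : V(G))
    (φ : Option V(G) ≃ V(H)) (ψ : Option E(G) ≃ E(H))
    (h0 : H.IsLink (ψ none) (φ (some v)) (φ none))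
    (h1 : ∀ (e : E(G)) (x y : V(G)), G.IsLink e x y →
      H.IsLink (ψ (some e)) (φ (some x)) (φ (some y))) :
    IsIso (G.attachEdge v) H := by
  refine isIso_of_isLink_imp ((attachEdgeVertexEquiv G v).trans φ)
    ((attachEdgeEdgeEquiv G v).trans ψ) ?_
  rintro ⟨e, he⟩ ⟨x, hx⟩ ⟨y, hy⟩ (⟨h, h'⟩ | ⟨e', x', y', h, h2, h3, h'⟩)
  · simp only at h h'
    subst h
    rw [Sym2.eq_iff] at h'
    rcases h' with ⟨rfl, rfl⟩ | ⟨rfl, rfl⟩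
    · exact h0.symm
    · exact h0
  · simp only at h h2 h3
    subst h h2 h3
    exact h1 ⟨e', h'.edge_mem⟩ ⟨x', h'.left_mem⟩ ⟨y', h'.right_mem⟩ h'

lemma attachEdge_isIso_attachEdge {G : Graph α β} {H : Graph α' β'} (φ : V(G) ≃ V(H))
    (ψ : E(G) ≃ E(H)) (h : ∀ (e : E(G)) (x y : V(G)), G.IsLink e x y ↔ H.IsLink (ψ e) (φ x) (φ y))
    (v : V(G)) : IsIso (G.attachEdge v) (H.attachEdge (φ v)) := by
  refine attachEdge_isIso v ((Equiv.optionCongr φ).trans (attachEdgeVertexEquiv H (φ v)).symm)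
    ((Equiv.optionCongr ψ).trans (attachEdgeEdgeEquiv H (φ v)).symm) ?_ ?_
  · exact Or.inl ⟨rfl, Sym2.eq_swap⟩
  · exact fun e x y hxy ↦ Or.inr ⟨ψ e, φ x, φ y, rfl, rfl, rfl, (h e x y).1 hxy⟩

/-- This gives every copy of `H'` in the random graph the same constant `r`. -/
lemma attachCount_congr {α₁ β₁ : Type*} {G : Graph α β} {H : Graph α' β'} (h : IsIso G H)
    (K : Graph α₁ β₁) : attachCount G K = attachCount H K := by
  obtain ⟨φ, ψ, h⟩ := h
  unfold attachCount
  refine Set.ncard_congr (fun v _ ↦ φ v) ?_ ?_ ?_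
  · exact fun v hv ↦ (attachEdge_isIso_attachEdge φ ψ h v).symm.trans hv
  · exact fun a b _ _ hab ↦ φ.injective hab
  · intro b hb
    refine ⟨φ.symm b, ?_, by simp⟩
    have := attachEdge_isIso_attachEdge φ ψ h (φ.symm b)
    rw [φ.apply_symm_apply] at this
    exact this.trans hb

end Iso

/-! ### Pendant edges, and counting copies of `H` over copies of `H'` -/

section LeafExt

variable {α β α' β' : Type*} {K' K G : Graph α β} {e : β} {v w : α}

/-- `K` is obtained from `K'` by adding a new vertex `w` and a new edge `e` from `v` to `w`. -/
structure IsLeafExt (K' K : Graph α β) (e : β) (v w : α) : Prop where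
  le : K' ≤ K
  isLink : K.IsLink e v w
  left_mem : v ∈ V(K')
  right_notMem : w ∉ V(K')
  vertexSet_eq : V(K) = insert w V(K')
  edgeSet_eq : E(K) = insert e E(K')

lemma IsLeafExt.edge_notMem (h : IsLeafExt K' K e v w) : e ∉ E(K') := fun he ↦
  h.right_notMem ((h.le.isLink_iff he).2 h.isLink).right_mem

lemma IsLeafExt.isIso (h : IsLeafExt K' K e v w) :
    IsIso (K'.attachEdge ⟨v, h.left_mem⟩) K := by
  have hw : w ∈ V(K) := h.isLink.right_mem
  have he : e ∈ E(K) := h.isLink.edge_mem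
  let φ : Option V(K') → V(K) := fun o ↦
    o.elim ⟨w, hw⟩ fun x ↦ ⟨x, h.le.vertexSet_mono x.2⟩
  let ψ : Option E(K') → E(K) := fun o ↦
    o.elim ⟨e, he⟩ fun x ↦ ⟨x, h.le.edgeSet_mono x.2⟩
  have hφ : φ.Bijective := by
    constructor
    · rintro (_ | ⟨x, hx⟩) (_ | ⟨y, hy⟩) hxy
      · rfl
      · obtain rfl : w = y := congrArg Subtype.val hxy
        exact absurd hy h.right_notMem
      · obtain rfl : x = w := congrArg Subtype.val hxy
        exact absurd hx h.right_notMem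
      · obtain rfl : x = y := congrArg Subtype.val hxy
        rfl
    · rintro ⟨x, hx⟩
      have hx' := hx
      rw [h.vertexSet_eq] at hx'
      rcases hx' with rfl | hx'
      · exact ⟨none, rfl⟩
      · exact ⟨some ⟨x, hx'⟩, rfl⟩
  have hψ : ψ.Bijective := by
    constructor
    · rintro (_ | ⟨x, hx⟩) (_ | ⟨y, hy⟩) hxy
      · rfl
      · obtain rfl : e = y := congrArg Subtype.val hxy
        exact absurd hy h.edge_notMem
      · obtain rfl : x = e := congrArg Subtype.val hxy
        exact absurd hx h.edge_notMem
      · obtain rfl : x = y := congrArg Subtype.val hxy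
        rfl
    · rintro ⟨x, hx⟩
      have hx' := hx
      rw [h.edgeSet_eq] at hx'
      rcases hx' with rfl | hx'
      · exact ⟨none, rfl⟩
      · exact ⟨some ⟨x, hx'⟩, rfl⟩
  exact attachEdge_isIso _ (Equiv.ofBijective φ hφ) (Equiv.ofBijective ψ hψ) h.isLink
    fun e x y hxy ↦ hxy.mono h.le

/-- The new vertex carries only the edge `e`, so no subgraph of minimum degree at least 2 contains
it. Thus `K'` can be recovered from `K`. -/
lemma IsLeafExt.isTwoCore (h : IsLeafExt K' K e v w) (hdeg : ∀ x ∈ V(K'), 2 ≤ K'.deg x) :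
    IsTwoCore K' K := by
  refine ⟨⟨h.le, hdeg⟩, ?_⟩
  rintro L ⟨hL, hLdeg⟩
  have hw : w ∉ V(L) := by
    intro hw
    obtain ⟨f, g, hfg, hf, hg⟩ := two_le_deg_iff.1 (hLdeg w hw)
    have key : ∀ f, L.Inc f w → f = e := by
      intro f hf
      have hf' := (hf.mono hL).edge_mem
      rw [h.edgeSet_eq] at hf'
      refine hf'.resolve_right fun h' ↦ h.right_notMem ?_
      exact ((h.le.inc_congr h').2 (hf.mono hL)).vertex_mem
    exact hfg ((key f hf).trans (key g hg).symm)
  constructor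
  · intro x hx
    have hx' := hL.vertexSet_mono hx
    rw [h.vertexSet_eq] at hx'
    exact hx'.resolve_left fun hh ↦ hw (hh ▸ hx)
  · intro f x y hxy
    have hf := (hxy.mono hL).edge_mem
    rw [h.edgeSet_eq] at hf
    rcases hf with rfl | hf
    · exact absurd ((hL.isLink_iff hxy.edge_mem).2 h.isLink).right_mem hw
    · exact (h.le.isLink_iff hf).2 (hxy.mono hL)

/-- The subgraph of `G` obtained from the subgraph `K'` by adding the edge `e`. -/
def addEdge (G K' : Graph α β) (e : β) : Graph α β :=
  (G.induce (V(K') ∪ {x | G.Inc e x})).restrict (insert e E(K'))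

lemma addEdge_le (hK : K' ≤ G) : addEdge G K' e ≤ G :=
  restrict_le.trans (induce_le (Set.union_subset hK.vertexSet_mono fun _ hx ↦ hx.vertex_mem))

lemma isLeafExt_addEdge (hK : K' ≤ G) (h : G.IsLink e v w) (hv : v ∈ V(K')) (hw : w ∉ V(K')) :
    IsLeafExt K' (addEdge G K' e) e v w where
  le := by
    refine ⟨Set.subset_union_left, fun f x y hxy ↦ ?_⟩
    exact ⟨Or.inr hxy.edge_mem, hxy.mono hK, Or.inl hxy.left_mem, Or.inl hxy.right_mem⟩
  isLink := ⟨Or.inl rfl, h, Or.inr h.inc_left, Or.inr h.inc_right⟩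
  left_mem := hv
  right_notMem := hw
  vertexSet_eq := by
    ext x
    change (x ∈ V(K') ∨ G.Inc e x) ↔ (x = w ∨ x ∈ V(K'))
    constructor
    · rintro (hx | hx)
      · exact Or.inr hx
      · rcases hx.eq_or_eq_of_isLink h with rfl | rfl
        · exact Or.inr hv
        · exact Or.inl rfl
    · rintro (rfl | hx)
      · exact Or.inr h.inc_right
      · exact Or.inl hx
  edgeSet_eq := by
    ext f
    constructor
    · exact fun hf ↦ hf.2
    · rintro (rfl | hf)
      · exact ⟨⟨v, w, h, Or.inr h.inc_left, Or.inr h.inc_right⟩, Or.inl rfl⟩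
      · obtain ⟨x, y, hxy⟩ := exists_isLink_of_mem_edgeSet hf
        exact ⟨⟨x, y, hxy.mono hK, Or.inl hxy.left_mem, Or.inl hxy.right_mem⟩, Or.inr hf⟩

lemma IsLeafExt.eq_addEdge (h : IsLeafExt K' K e v w) (hK : K ≤ G) : K = addEdge G K' e := by
  have h2 := isLeafExt_addEdge (h.le.trans hK) (h.isLink.mono hK) h.left_mem h.right_notMem
  refine (Compatible.of_le_le hK (addEdge_le (h.le.trans hK))).ext ?_ ?_
  · rw [h.vertexSet_eq, h2.vertexSet_eq]
  · rw [h.edgeSet_eq, h2.edgeSet_eq]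

/-- Pulling `H'` back along the isomorphism splits each copy of `H` into a copy of `H'` and a
pendant edge. -/
lemma IsLeafExt.exists_of_isIso {H' H : Graph α' β'} {e₀ : β'} {v₀ w₀ : α'}
    (h : IsLeafExt H' H e₀ v₀ w₀) (hiso : IsIso K H) :
    ∃ K' e v w, IsLeafExt K' K e v w ∧ IsIso K' H' := by
  obtain ⟨φ, ψ, hφ⟩ := hiso
  let w : V(K) := φ.symm ⟨w₀, h.isLink.right_mem⟩
  let v : V(K) := φ.symm ⟨v₀, h.isLink.left_mem⟩
  let e : E(K) := ψ.symm ⟨e₀, h.isLink.edge_mem⟩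
  let K' : Graph α β := (K.induce {x | ∃ hx : x ∈ V(K), (φ ⟨x, hx⟩ : α') ∈ V(H')}).restrict
    {f | ∃ hf : f ∈ E(K), (ψ ⟨f, hf⟩ : β') ∈ E(H')}
  have hKV : ∀ x, x ∈ V(K') ↔ ∃ hx : x ∈ V(K), (φ ⟨x, hx⟩ : α') ∈ V(H') := fun x ↦ Iff.rfl
  have hKL : ∀ (f : E(K)) (x y : V(K)), K'.IsLink f x y ↔ H'.IsLink (ψ f) (φ x) (φ y) := by
    intro f x y
    constructor
    · rintro ⟨⟨hf, hf'⟩, hxy, -, -⟩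
      exact (h.le.isLink_iff hf').2 ((hφ f x y).1 hxy)
    · intro hxy
      exact ⟨⟨f.2, hxy.edge_mem⟩, (hφ f x y).2 (hxy.mono h.le), ⟨x.2, hxy.left_mem⟩,
        ⟨y.2, hxy.right_mem⟩⟩
  have hle : K' ≤ K := restrict_le.trans (induce_le fun x hx ↦ hx.1)
  have hKE : ∀ f, f ∈ E(K') ↔ ∃ hf : f ∈ E(K), (ψ ⟨f, hf⟩ : β') ∈ E(H') := by
    intro f
    constructor
    · exact fun hf ↦ hf.2
    · rintro ⟨hf, hf'⟩
      obtain ⟨x, y, hxy⟩ := exists_isLink_of_mem_edgeSet hf'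
      have hx := h.le.vertexSet_mono hxy.left_mem
      have hy := h.le.vertexSet_mono hxy.right_mem
      exact ((hKL ⟨f, hf⟩ (φ.symm ⟨x, hx⟩) (φ.symm ⟨y, hy⟩)).2 (by simpa using hxy)).edge_mem
  refine ⟨K', e, v, w, ⟨hle, ?_, ?_, ?_, ?_, ?_⟩, ?_⟩
  · exact (hφ e v w).2 (by simpa [e, v, w] using h.isLink)
  · exact (hKV _).2 ⟨v.2, by simpa [v] using h.left_mem⟩
  · rintro hw
    obtain ⟨hw, hw'⟩ := (hKV _).1 hw
    exact h.right_notMem (by simpa [w] using hw')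
  · ext x
    constructor
    · intro hx
      have h2 := h.vertexSet_eq.subset (φ ⟨x, hx⟩).2
      rcases h2 with h2 | h2
      · left
        have : φ ⟨x, hx⟩ = ⟨w₀, h.isLink.right_mem⟩ := Subtype.ext h2
        simp [w, ← this]
      · exact Or.inr ((hKV x).2 ⟨hx, h2⟩)
    · rintro (rfl | hx)
      · exact w.2
      · exact hle.vertexSet_mono hx
  · ext x
    constructor
    · intro hx
      have h2 := h.edgeSet_eq.subset (ψ ⟨x, hx⟩).2
      rcases h2 with h2 | h2
      · left
        have : ψ ⟨x, hx⟩ = ⟨e₀, h.isLink.edge_mem⟩ := Subtype.ext h2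
        simp [e, ← this]
      · exact Or.inr ((hKE x).2 ⟨hx, h2⟩)
    · rintro (rfl | hx)
      · exact e.2
      · exact hle.edgeSet_mono hx
  · have hV (x : V(K')) : (φ ⟨x, hle.vertexSet_mono x.2⟩ : α') ∈ V(H') := by
      obtain ⟨h1, h2⟩ := (hKV x).1 x.2
      exact h2
    have hE (x : E(K')) : (ψ ⟨x, hle.edgeSet_mono x.2⟩ : β') ∈ E(H') := by
      obtain ⟨h1, h2⟩ := (hKE x).1 x.2
      exact h2
    refine isIso_of_isLink_imp
      (Equiv.ofBijective (fun x : V(K') ↦ (⟨φ ⟨x, hle.vertexSet_mono x.2⟩, hV x⟩ : V(H'))) ⟨?_, ?_⟩)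
      (Equiv.ofBijective (fun x : E(K') ↦ (⟨ψ ⟨x, hle.edgeSet_mono x.2⟩, hE x⟩ : E(H'))) ⟨?_, ?_⟩)
      ?_
    · intro x y hxy
      simpa [Subtype.ext_iff, ← Subtype.ext_iff] using hxy
    · rintro ⟨y, hy⟩
      have hy' := h.le.vertexSet_mono hy
      exact ⟨⟨φ.symm ⟨y, hy'⟩, (hKV _).2 ⟨(φ.symm ⟨y, hy'⟩).2, by simpa using hy⟩⟩, by simp⟩
    · intro x y hxy
      simpa [Subtype.ext_iff, ← Subtype.ext_iff] using hxy
    · rintro ⟨y, hy⟩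
      have hy' := h.le.edgeSet_mono hy
      exact ⟨⟨ψ.symm ⟨y, hy'⟩, (hKE _).2 ⟨(ψ.symm ⟨y, hy'⟩).2, by simpa using hy⟩⟩, by simp⟩
    · intro f x y hxy
      exact (hKL ⟨f, hle.edgeSet_mono f.2⟩ ⟨x, hle.vertexSet_mono x.2⟩
        ⟨y, hle.vertexSet_mono y.2⟩).1 hxy

/-- The edges of `G` which extend the subgraph `K'` to a copy of `H` by a pendant edge. -/
def leafEdges (H : Graph α' β') (K' G : Graph α β) : Set β :=
  {e | ∃ v, ∃ hv : v ∈ V(K'), ∃ w, w ∉ V(K') ∧ G.IsLink e v w ∧ IsIso (K'.attachEdge ⟨v, hv⟩) H}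

/-- The map `(K', e) ↦ addEdge G K' e` is a bijection from the pairs counted on the right onto the
copies of `H`. -/
lemma ncard_copies_eq_sum {H' H : Graph α' β'} {e₀ : β'} {v₀ w₀ : α'}
    (h : IsLeafExt H' H e₀ v₀ w₀) (hdeg : ∀ x ∈ V(H'), 2 ≤ H'.deg x) (hE : E(G).Finite)
    (hfin : (copies H' G).Finite) :
    (copies H G).ncard = ∑ K' ∈ hfin.toFinset, (leafEdges H K' G).ncard := by
  have hfin' (K' : Graph α β) : (leafEdges H K' G).Finite :=
    hE.subset fun e ⟨_, _, _, _, hl, _⟩ ↦ hl.edge_mem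
  have hdeg' (K' : Graph α β) (hK : IsIso K' H') := hK.two_le_deg hdeg
  let s : Finset (Σ _ : Graph α β, β) := hfin.toFinset.sigma fun K' ↦ (hfin' K').toFinset
  have hs : s.card = ∑ K' ∈ hfin.toFinset, (leafEdges H K' G).ncard := by
    rw [Finset.card_sigma]
    exact Finset.sum_congr rfl fun K' _ ↦ (Set.ncard_eq_toFinset_card _ _).symm
  have hmem (p : Σ _ : Graph α β, β) : p ∈ (s : Set (Σ _ : Graph α β, β)) ↔
      p.1 ∈ copies H' G ∧ p.2 ∈ leafEdges H p.1 G := by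
    simp [s]
  have himage : (fun p : (Σ _ : Graph α β, β) ↦ addEdge G p.1 p.2) '' s = copies H G := by
    ext K
    constructor
    · rintro ⟨⟨K', e⟩, hp, rfl⟩
      obtain ⟨⟨hle, hiso⟩, v, hv, w, hw, hl, hat⟩ := (hmem _).1 hp
      exact ⟨addEdge_le hle, (isLeafExt_addEdge hle hl hv hw).isIso.symm.trans hat⟩
    · rintro ⟨hle, hiso⟩
      obtain ⟨K', e, v, w, hext, hiso'⟩ := h.exists_of_isIso hiso
      refine ⟨⟨K', e⟩, (hmem _).2 ⟨⟨hext.le.trans hle, hiso'⟩, v, hext.left_mem, w,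
        hext.right_notMem, hext.isLink.mono hle, hext.isIso.trans hiso⟩, ?_⟩
      exact (hext.eq_addEdge hle).symm
  rw [← himage, Set.InjOn.ncard_image, Set.ncard_coe_finset, hs]
  rintro ⟨K, e⟩ hp ⟨L, f⟩ hq hpq
  obtain ⟨⟨hle, hiso⟩, v, hv, w, hw, hl, -⟩ := (hmem _).1 hp
  obtain ⟨⟨hle', hiso'⟩, v', hv', w', hw', hl', -⟩ := (hmem _).1 hq
  have h1 := isLeafExt_addEdge hle hl hv hw
  have h2 := isLeafExt_addEdge hle' hl' hv' hw'
  simp only at hpq h1 h2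
  rw [hpq] at h1
  -- Both are the 2-core of the same graph; the added edge is then the only one outside it.
  obtain rfl : K = L :=
    IsGreatest.unique (h1.isTwoCore (hdeg' K hiso)) (h2.isTwoCore (hdeg' L hiso'))
  have h3 := h1.isLink.edge_mem
  rw [h2.edgeSet_eq] at h3
  rw [h3.resolve_right h1.edge_notMem]

end LeafExt

end Graph
-- Structure of the 2-core and the strict edge-count inequality
namespace Graph

section TwoCore

variable {α β : Type*} {H H' G : Graph α β}

lemma two_le_deg_cycle {ℓ : ℕ} (hℓ : 2 ≤ ℓ) (x : ZMod ℓ) : 2 ≤ (cycle ℓ).deg x := by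
  have : Fact (1 < ℓ) := ⟨hℓ⟩
  refine two_le_deg_iff.2 ⟨x, x - 1, ?_, ⟨x + 1, rfl⟩, ⟨x - 1, ?_⟩⟩
  · intro h
    have h1 : (1 : ZMod ℓ) = 0 := by linear_combination h
    exact one_ne_zero h1
  · change s(x, x - 1) = s(x - 1, x - 1 + 1)
    rw [sub_add_cancel, Sym2.eq_swap]

lemma two_le_deg_of_mem_cycles {C : Graph α β} (hC : C ∈ G.cycles) : ∀ x ∈ V(C), 2 ≤ C.deg x := by
  obtain ⟨ℓ, hℓ, -, hiso⟩ := hC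
  exact hiso.two_le_deg fun x _ ↦ two_le_deg_cycle hℓ x

lemma vertexSet_nonempty_of_mem_cycles {C : Graph α β} (hC : C ∈ G.cycles) : V(C).Nonempty := by
  obtain ⟨ℓ, hℓ, -, φ, -, -⟩ := hC
  exact ⟨φ.symm ⟨0, Set.mem_univ _⟩, Subtype.coe_prop _⟩

lemma le_of_mem_cycles {C : Graph α β} (hC : C ∈ G.cycles) : C ≤ G := by
  obtain ⟨ℓ, hℓ, hle, -⟩ := hC
  exact hle

/-- Every cycle has minimum degree at least 2 and therefore lies in the 2-core. -/
lemma IsTwoCore.isMulticyclic (h : IsTwoCore H' H) (hH : H.IsMulticyclic) :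
    H'.IsMulticyclic := by
  refine le_trans hH (Set.encard_le_encard ?_)
  intro C hC
  have h1 : C ≤ H' := h.2 ⟨le_of_mem_cycles hC, two_le_deg_of_mem_cycles hC⟩
  obtain ⟨ℓ, hℓ, -, hiso⟩ := hC
  exact ⟨ℓ, hℓ, h1, hiso⟩

lemma IsMulticyclic.vertexSet_nonempty (h : G.IsMulticyclic) : V(G).Nonempty := by
  have : G.cycles.Nonempty := by
    rw [← Set.encard_pos]
    exact lt_of_lt_of_le (by norm_num) h
  obtain ⟨C, hC⟩ := this
  exact (vertexSet_nonempty_of_mem_cycles hC).mono (le_of_mem_cycles hC).vertexSet_mono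

lemma IsTwoCore.exists_isLeafExt [hloop : H.Loopless] (hconn : H.IsConnected)
    (hmulti : H.IsMulticyclic) (hcore : IsTwoCore H' H) (ht : (V(H) \ V(H')).ncard = 1) :
    ∃ e v w, IsLeafExt H' H e v w := by
  obtain ⟨w, hw⟩ := Set.ncard_eq_one.1 ht
  obtain ⟨hle, hdeg⟩ := hcore.1
  have hwm : w ∈ V(H) \ V(H') := hw ▸ rfl
  have hVH : ∀ x ∈ V(H), x ≠ w → x ∈ V(H') := by
    intro x hx hxw
    by_contra hx'
    have : x ∈ V(H) \ V(H') := ⟨hx, hx'⟩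
    rw [hw] at this
    exact hxw this
  obtain ⟨x₀, hx₀⟩ := (hcore.isMulticyclic hmulti).vertexSet_nonempty
  obtain ⟨v, ⟨e, hev⟩⟩ : ∃ v, H.Adj w v := by
    rcases (hconn.2 w hwm.1 x₀ (hle.vertexSet_mono hx₀)).cases_head with h | ⟨c, hc, -⟩
    · exact absurd (h ▸ hx₀) hwm.2
    · exact ⟨c, hc⟩
  have hv : v ∈ V(H') := hVH v hev.right_mem hev.ne.symm
  have huniq : ∀ f, H.Inc f w → f = e := by
    intro f hf
    by_contra hfe
    -- With a second edge at `w`, `H` itself would have minimum degree at least 2 and be contained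
    -- in its 2-core.
    refine hwm.2 (IsSubgraph.vertexSet_mono (hcore.2 ⟨le_rfl, fun x hx ↦ ?_⟩) hwm.1)
    by_cases hxw : x = w
    · subst hxw
      exact two_le_deg_iff.2 ⟨f, e, hfe, hf, hev.inc_left⟩
    · exact two_le_deg_mono hle (hdeg x (hVH x hx hxw))
  -- Deleting `w` leaves a graph containing `H'` on the same vertices, so maximality of the 2-core
  -- applies. Hence every edge other than `e` lies in `H'`.
  have hdel : H.deleteVerts {w} ≤ H' := by
    refine hcore.2 ⟨deleteVerts_le, fun x hx ↦ ?_⟩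
    have hx' : x ∈ V(H') := by
      rw [vertexSet_deleteVerts] at hx
      exact hVH x hx.1 hx.2
    refine two_le_deg_mono (K := H') ⟨fun y hy ↦ ?_, fun f a b hab ↦ ?_⟩ (hdeg x hx')
    · rw [vertexSet_deleteVerts]
      exact ⟨hle.vertexSet_mono hy, fun hyw ↦ hwm.2 (hyw ▸ hy)⟩
    · rw [deleteVerts_isLink]
      exact ⟨hab.mono hle, fun haw ↦ hwm.2 (haw ▸ hab.left_mem),
        fun haw ↦ hwm.2 (haw ▸ hab.right_mem)⟩
  refine ⟨e, v, w, hle, hev.symm, hv, hwm.2, ?_, ?_⟩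
  · ext x
    constructor
    · intro hx
      by_cases hxw : x = w
      · exact Or.inl hxw
      · exact Or.inr (hVH x hx hxw)
    · rintro (rfl | hx)
      · exact hwm.1
      · exact hle.vertexSet_mono hx
  · ext f
    constructor
    · intro hf
      by_cases hfe : f = e
      · exact Or.inl hfe
      · obtain ⟨a, b, hab⟩ := exists_isLink_of_mem_edgeSet hf
        refine Or.inr (IsLink.mono hdel (x := a) (y := b) ?_).edge_mem
        rw [deleteVerts_isLink]
        exact ⟨hab, fun h ↦ hfe (huniq f (h ▸ hab.inc_left)),
          fun h ↦ hfe (huniq f (h ▸ hab.inc_right))⟩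
    · rintro (rfl | hf)
      · exact hev.edge_mem
      · exact hle.edgeSet_mono hf

lemma IsLeafExt.eq_vertexSet_of_adj_closed {e : β} {v w : α} (h : IsLeafExt H' H e v w)
    (hconn : H.IsConnected) {S : Set α} (hS : S ⊆ V(H')) (hne : S.Nonempty)
    (hadj : ∀ x ∈ S, ∀ y, H'.Adj x y → y ∈ S) : S = V(H') := by
  refine hS.antisymm fun y hy ↦ ?_
  obtain ⟨x, hx⟩ := hne
  -- `S`, together with `w` when `v ∈ S`, is closed under adjacency in `H`, so connectedness of `H`
  -- passes to `H'`.
  let T : Set α := S ∪ {u | u = w ∧ v ∈ S}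
  have hT : ∀ a ∈ T, ∀ b, H.Adj a b → b ∈ T := by
    rintro a ha b ⟨f, hf⟩
    have hfm := hf.edge_mem
    rw [h.edgeSet_eq] at hfm
    rcases hfm with rfl | hfm
    · rcases hf.eq_and_eq_or_eq_and_eq h.isLink with ⟨rfl, rfl⟩ | ⟨rfl, rfl⟩
      · refine Or.inr ⟨rfl, ha.resolve_right fun h' ↦ h.right_notMem ?_⟩
        exact h'.1 ▸ h.left_mem
      · rcases ha with ha | ha
        · exact absurd (hS ha) h.right_notMem
        · exact Or.inl ha.2
    · have hf' := (h.le.isLink_iff hfm).2 hf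
      rcases ha with ha | ⟨rfl, -⟩
      · exact Or.inl (hadj a ha b ⟨f, hf'⟩)
      · exact absurd hf'.left_mem h.right_notMem
  have key : ∀ y, Relation.ReflTransGen H.Adj x y → y ∈ T := by
    intro y hxy
    induction hxy with
    | refl => exact Or.inl hx
    | tail _ hbc ih => exact hT _ ih _ hbc
  rcases key y (hconn.2 x (h.le.vertexSet_mono (hS hx)) y (h.le.vertexSet_mono hy)) with h1 | ⟨rfl, -⟩
  · exact h1
  · exact absurd hy h.right_notMem

/-- If all degrees in a "connected" graph are two, it contains at most one cycle. -/
lemma not_isMulticyclic_of_deg_eq_two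
    (hconn : ∀ S ⊆ V(G), S.Nonempty → (∀ x ∈ S, ∀ y, G.Adj x y → y ∈ S) → S = V(G))
    (hdeg : ∀ x ∈ V(G), G.deg x = 2) : ¬ G.IsMulticyclic := by
  intro h
  have hsub : G.cycles ⊆ {G} := by
    intro C hC
    have hle := le_of_mem_cycles hC
    have hinc : ∀ x ∈ V(C), ∀ e, G.Inc e x → C.Inc e x := by
      intro x hx e he
      have hfin : (G.incidenceSet x).Finite := by
        rw [← Set.encard_ne_top_iff]
        change G.deg x ≠ ⊤
        rw [hdeg x (hle.vertexSet_mono hx)]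
        simp
      -- `C` uses at least two edges at `x` and `G` has exactly two; so `C` is closed under
      -- adjacency and exhausts `G`.
      have heq : C.incidenceSet x = G.incidenceSet x := by
        have hsub : C.incidenceSet x ⊆ G.incidenceSet x := fun f hf ↦
          Inc.mono hle ((mem_incidenceSet ..).1 hf)
        refine (hfin.subset hsub).eq_of_subset_of_encard_le hsub ?_
        exact (hdeg x (hle.vertexSet_mono hx)).le.trans (two_le_deg_of_mem_cycles hC x hx)
      exact heq.symm.subset he
    have hV : V(C) = V(G) := by
      refine hconn _ hle.vertexSet_mono (vertexSet_nonempty_of_mem_cycles hC) ?_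
      rintro x hx y ⟨e, he⟩
      exact ((hle.isLink_iff (hinc x hx e he.inc_left).edge_mem).2 he).right_mem
    refine (Compatible.of_le hle).ext hV (hle.edgeSet_mono.antisymm fun e he ↦ ?_)
    obtain ⟨x, y, hxy⟩ := exists_isLink_of_mem_edgeSet he
    exact (hinc x (hV ▸ hxy.left_mem) e hxy.inc_left).edge_mem
  have h2 := le_trans h (Set.encard_le_encard hsub)
  rw [Set.encard_singleton] at h2
  exact absurd h2 (by norm_num)

/-- In a connected multicyclic graph with all degrees at least two, every nonempty set of vertices
touches more edges than it has elements. -/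
lemma card_lt_card_touching
    (hconn : ∀ S ⊆ V(G), S.Nonempty → (∀ x ∈ S, ∀ y, G.Adj x y → y ∈ S) → S = V(G))
    (hdeg : ∀ x ∈ V(G), 2 ≤ G.deg x) (hmulti : G.IsMulticyclic)
    (S : Finset α) (hS : (S : Set α) ⊆ V(G)) (hne : S.Nonempty) (T : Finset β)
    (hT : ∀ e, e ∈ T ↔ ∃ x ∈ S, G.Inc e x) : S.card < T.card := by
  classical
  by_contra! hlt
  -- Counting incidences between `S` and `T` gives `2|S| ≤ ∑ deg ≤ 2|T|`, so `|T| ≤ |S|` forces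
  -- equality in every term.
  have hcount := Finset.sum_card_bipartiteAbove_eq_sum_card_bipartiteBelow
    (s := S) (t := T) (fun x e ↦ G.Inc e x)
  have habove : ∀ x ∈ S, ((T.bipartiteAbove (fun x e ↦ G.Inc e x) x).card : ℕ∞) = G.deg x := by
    intro x hx
    rw [deg, ← Set.encard_coe_eq_coe_finsetCard]
    congr 1
    ext e
    simp only [Finset.mem_coe, Finset.mem_bipartiteAbove, mem_incidenceSet, hT]
    exact ⟨fun h ↦ h.2, fun h ↦ ⟨⟨x, hx, h⟩, h⟩⟩
  have h1 : ∀ x ∈ S, 2 ≤ (T.bipartiteAbove (fun x e ↦ G.Inc e x) x).card := by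
    intro x hx
    have := hdeg x (hS hx)
    rw [← habove x hx] at this
    exact_mod_cast this
  have hpair : ∀ e ∈ T, ∃ x y, G.IsLink e x y ∧
      S.bipartiteBelow (fun x e ↦ G.Inc e x) e ⊆ {x, y} := by
    intro e he
    obtain ⟨x, hx, y, hxy⟩ := (hT e).1 he
    refine ⟨x, y, hxy, fun z hz ↦ ?_⟩
    rw [Finset.mem_bipartiteBelow] at hz
    simpa using hz.2.eq_or_eq_of_isLink hxy
  have h2 : ∀ e ∈ T, (S.bipartiteBelow (fun x e ↦ G.Inc e x) e).card ≤ 2 := by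
    intro e he
    obtain ⟨x, y, -, hsub⟩ := hpair e he
    exact (Finset.card_le_card hsub).trans Finset.card_le_two
  have h3 : S.card * 2 ≤ ∑ x ∈ S, (T.bipartiteAbove (fun x e ↦ G.Inc e x) x).card := by
    simpa using Finset.card_nsmul_le_sum S _ 2 h1
  have h4 : ∑ e ∈ T, (S.bipartiteBelow (fun x e ↦ G.Inc e x) e).card ≤ T.card * 2 := by
    simpa using Finset.sum_le_card_nsmul T _ 2 h2
  have h5 : ∑ x ∈ S, (T.bipartiteAbove (fun x e ↦ G.Inc e x) x).card = ∑ x ∈ S, 2 := by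
    simp only [Finset.sum_const, smul_eq_mul]
    omega
  have h6 : ∑ e ∈ T, (S.bipartiteBelow (fun x e ↦ G.Inc e x) e).card = ∑ e ∈ T, 2 := by
    simp only [Finset.sum_const, smul_eq_mul]
    omega
  have h7 := (Finset.sum_eq_sum_iff_of_le h1).1 h5.symm
  have h8 := (Finset.sum_eq_sum_iff_of_le h2).1 h6
  -- By equality every edge touching `S` has both ends in `S`, so `S` is everything and all degrees
  -- are 2: at most one cycle.
  have hSV : (S : Set α) = V(G) := by
    refine hconn _ hS (by simpa using hne) ?_
    rintro x hx y ⟨e, he⟩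
    have heT : e ∈ T := (hT e).2 ⟨x, hx, he.inc_left⟩
    obtain ⟨a, b, hab, hsub⟩ := hpair e heT
    have heq := Finset.eq_of_subset_of_card_le hsub (by rw [h8 e heT]; exact Finset.card_le_two)
    have hy : y ∈ ({a, b} : Finset α) := by
      simpa using he.inc_right.eq_or_eq_of_isLink hab
    rw [← heq, Finset.mem_bipartiteBelow] at hy
    exact hy.1
  refine not_isMulticyclic_of_deg_eq_two hconn (fun x hx ↦ ?_) hmulti
  rw [← hSV] at hx
  rw [← habove x hx, ← h7 x hx]
  rfl

end TwoCore

end Graph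
-- Layer-cake comparison of products
section Summation

lemma log_eq_sum_ite {N M : ℕ} (hN : 1 ≤ N) (hM : N ≤ M) :
    Real.log N = ∑ t ∈ Finset.Ico 1 M,
      if t < N then Real.log ((t + 1 : ℕ) : ℝ) - Real.log (t : ℝ) else 0 := by
  rw [← Finset.sum_filter]
  have : (Finset.Ico 1 M).filter (· < N) = Finset.Ico 1 N := by
    ext t
    simp only [Finset.mem_filter, Finset.mem_Ico]
    omega
  rw [this, Finset.sum_Ico_sub (fun t : ℕ ↦ Real.log (t : ℝ)) hN]
  simp

lemma sum_log_eq_sum_card_mul {ι : Type*} [Fintype ι] (z : ι → ℕ) {M : ℕ} (hz : ∀ i, 1 ≤ z i)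
    (hM : ∀ i, z i ≤ M) :
    ∑ i, Real.log (z i) = ∑ t ∈ Finset.Ico 1 M,
      ((Finset.univ.filter fun i ↦ t < z i).card : ℝ) *
        (Real.log ((t + 1 : ℕ) : ℝ) - Real.log (t : ℝ)) := by
  rw [Finset.sum_congr rfl fun i _ ↦ log_eq_sum_ite (hz i) (hM i), Finset.sum_comm]
  refine Finset.sum_congr rfl fun t _ ↦ ?_
  rw [← Finset.sum_filter, Finset.sum_const, nsmul_eq_mul]

/-- Layer-cake comparison of sums of logarithms. -/
lemma sum_log_le_sum_log {ι κ : Type*} [Fintype ι] [Fintype κ] (a b : ℕ) (x : ι → ℕ) (y : κ → ℕ)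
    (hx : ∀ i, 1 ≤ x i) (hy : ∀ j, 1 ≤ y j)
    (h : ∀ t, a * (Finset.univ.filter fun i ↦ t < x i).card ≤
      b * (Finset.univ.filter fun j ↦ t < y j).card) :
    (a : ℝ) * ∑ i, Real.log (x i) ≤ b * ∑ j, Real.log (y j) := by
  obtain ⟨M, hMx, hMy⟩ : ∃ M, (∀ i, x i ≤ M) ∧ ∀ j, y j ≤ M :=
    ⟨∑ i, x i + ∑ j, y j,
      fun i ↦ (Finset.single_le_sum (fun _ _ ↦ Nat.zero_le _) (Finset.mem_univ i)).trans
        (Nat.le_add_right _ _),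
      fun j ↦ (Finset.single_le_sum (fun _ _ ↦ Nat.zero_le _) (Finset.mem_univ j)).trans
        (Nat.le_add_left _ _)⟩
  rw [sum_log_eq_sum_card_mul x hx hMx, sum_log_eq_sum_card_mul y hy hMy, Finset.mul_sum, Finset.mul_sum]
  refine Finset.sum_le_sum fun t ht ↦ ?_
  rw [← mul_assoc, ← mul_assoc]
  refine mul_le_mul_of_nonneg_right (by exact_mod_cast h t) ?_
  have ht' : (0 : ℝ) < t := by exact_mod_cast (Finset.mem_Ico.1 ht).1
  rw [sub_nonneg]
  exact Real.log_le_log ht' (by push_cast; linarith)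

lemma tsum_pi_prod_le {ι : Type*} [Fintype ι] (g : ℕ → ℝ≥0∞) :
    ∑' φ : ι → ℕ, ∏ i, g (φ i) ≤ (∑' n, g n) ^ Fintype.card ι := by
  classical
  rw [ENNReal.tsum_eq_iSup_sum]
  refine iSup_le fun s ↦ ?_
  let t : Finset ℕ := s.biUnion fun φ ↦ Finset.univ.image φ
  have hst : s ⊆ Fintype.piFinset fun _ : ι ↦ t := by
    intro φ hφ
    rw [Fintype.mem_piFinset]
    exact fun i ↦ Finset.mem_biUnion.2 ⟨φ, hφ, Finset.mem_image_of_mem _ (Finset.mem_univ i)⟩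
  calc ∑ φ ∈ s, ∏ i, g (φ i) ≤ ∑ φ ∈ Fintype.piFinset fun _ : ι ↦ t, ∏ i, g (φ i) :=
        Finset.sum_le_sum_of_subset hst
    _ = ∏ _i : ι, ∑ n ∈ t, g n := (Finset.prod_univ_sum (fun _ ↦ t) fun _ ↦ g).symm
    _ ≤ ∏ _i : ι, ∑' n, g n := Finset.prod_le_prod' fun _ _ ↦ ENNReal.sum_le_tsum t
    _ = _ := by simp

/-- Here `x` stands for the positions of the vertices and `y` for the younger ends of the edges. The
gain from `k` to `k + 1` puts the exponent beyond 1, which makes the sum over positions converge. -/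
lemma prod_two_div_le {ι κ : Type*} [Fintype ι] [Fintype κ] (k : ℕ) (hk : 0 < k) (x : ι → ℕ)
    (y : κ → ℕ) (hx : ∀ i, 1 ≤ x i) (hy : ∀ j, 1 ≤ y j)
    (h : ∀ t, (k + 1) * (Finset.univ.filter fun i ↦ t < x i).card ≤
      k * (Finset.univ.filter fun j ↦ t < y j).card) :
    ∏ j, (2 / (y j : ℝ)) ≤ 2 ^ Fintype.card κ * ∏ i, (x i : ℝ) ^ (-(1 + 1 / k : ℝ)) := by
  have hk' : (0 : ℝ) < k := by exact_mod_cast hk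
  have h1 := sum_log_le_sum_log (k + 1) k x y hx hy h
  have h2 : (1 + 1 / k : ℝ) * ∑ i, Real.log (x i) ≤ ∑ j, Real.log (y j) := by
    have hk1 : (k : ℝ) * (1 + 1 / k) = ((k + 1 : ℕ) : ℝ) := by
      push_cast
      field_simp
    rw [← mul_le_mul_iff_right₀ hk', ← mul_assoc, hk1]
    exact h1
  have hxp (i : ι) : (0 : ℝ) < x i := by exact_mod_cast hx i
  have hyp (j : κ) : (0 : ℝ) < y j := by exact_mod_cast hy j
  have h3 : ∏ i, (x i : ℝ) ^ (-(1 + 1 / k : ℝ)) =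
      Real.exp (-((1 + 1 / k : ℝ) * ∑ i, Real.log (x i))) := by
    rw [Finset.mul_sum, ← Finset.sum_neg_distrib, Real.exp_sum]
    refine Finset.prod_congr rfl fun i _ ↦ ?_
    rw [Real.rpow_def_of_pos (hxp i)]
    ring_nf
  have h4 : ∏ j, (2 / (y j : ℝ)) = 2 ^ Fintype.card κ * Real.exp (-∑ j, Real.log (y j)) := by
    rw [← Finset.sum_neg_distrib, Real.exp_sum, Fintype.card, ← Finset.prod_const,
      ← Finset.prod_mul_distrib]
    refine Finset.prod_congr rfl fun j _ ↦ ?_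
    rw [Real.exp_neg, Real.exp_log (hyp j), div_eq_mul_inv]
  rw [h3, h4]
  gcongr

end Summation

/-! ### Almost sure finiteness of the number of copies of the 2-core -/

section Finiteness

variable {α β Ω : Type*} [MeasurableSpace Ω] {μ : Measure Ω} {m : ℕ}
  {U : ℕ → Fin m → Ω → ℕ}

lemma IsUniformAttachment.measure_forall_eq_le (hU : IsUniformAttachment U μ) {κ : Type*}
    [Fintype κ] (j : κ → ℕ) (i : κ → ℕ) (l : κ → Fin m) (hi : ∀ e, 1 ≤ i e)
    (hij : ∀ e, i e < j e) (hinj : Function.Injective fun e ↦ (j e, l e)) :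
    μ {ω | ∀ e, U (j e) (l e) ω = i e} ≤ ENNReal.ofReal (∏ e, (2 / (j e : ℝ))) := by
  have hj (e : κ) : 2 ≤ j e := by have := hi e; have := hij e; omega
  let g : κ → {j : ℕ // 2 ≤ j} × Fin m := fun e ↦ (⟨j e, hj e⟩, l e)
  have hg : g.Injective := by
    intro a b hab
    apply hinj
    simp only [g, Prod.mk.injEq, Subtype.mk.injEq] at hab
    simpa using hab
  have h1 := (hU.indep.precomp hg).measure_inter_preimage_eq_mul Finset.univ
    (sets := fun e ↦ {i e}) (fun _ _ ↦ MeasurableSet.of_discrete)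
  have h2 : {ω | ∀ e, U (j e) (l e) ω = i e} =
      ⋂ e ∈ (Finset.univ : Finset κ), (fun ω ↦ U (j e) (l e) ω) ⁻¹' {i e} := by
    ext ω
    simp
  rw [h2]
  refine h1.le.trans ?_
  rw [ENNReal.ofReal_prod_of_nonneg fun e _ ↦ by positivity]
  refine Finset.prod_le_prod' fun e _ ↦ ?_
  have h3 := hU.uniform (j e) (hj e) (l e) (i e) (hi e) (hij e)
  refine (le_of_eq h3).trans ?_
  have hj' : (2 : ℝ) ≤ j e := by exact_mod_cast hj e
  have hpos : (0 : ℝ) < ((j e - 1 : ℕ) : ℝ) := by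
    rw [Nat.cast_sub (by have := hj e; omega)]
    push_cast
    linarith
  have h4 : (1 : ℝ≥0∞) / ((j e - 1 : ℕ) : ℝ≥0∞) = ENNReal.ofReal (1 / ((j e - 1 : ℕ) : ℝ)) := by
    rw [ENNReal.ofReal_div_of_pos hpos]
    simp
  rw [h4]
  refine ENNReal.ofReal_le_ofReal ?_
  -- `1 / (j - 1) ≤ 2 / j` because `j ≥ 2`.
  rw [div_le_div_iff₀ hpos (by linarith), Nat.cast_sub (by have := hj e; omega)]
  push_cast
  linarith

/-- Almost surely, there are only finitely many embeddings with given labels of the edges. -/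
lemma IsUniformAttachment.ae_finite_embeddings (hU : IsUniformAttachment U μ) {ι κ : Type*}
    [Fintype ι] [Fintype κ] [Nonempty ι] (x y : κ → ι) (hxy : ∀ e, x e ≠ y e)
    (hcount : ∀ S : Finset ι, S.Nonempty → ∀ T : Finset κ,
      (∀ e, e ∈ T ↔ x e ∈ S ∨ y e ∈ S) → S.card < T.card) (l : κ → Fin m) :
    ∀ᵐ ω ∂μ, {φ : ι → ℕ | φ.Injective ∧ (∀ v, 1 ≤ φ v) ∧
      (Function.Injective fun e ↦ (max (φ (x e)) (φ (y e)), l e)) ∧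
      ∀ e, U (max (φ (x e)) (φ (y e))) (l e) ω = min (φ (x e)) (φ (y e))}.Finite := by
  classical
  set k := Fintype.card ι with hk
  have hk0 : 0 < k := Fintype.card_pos
  let g : ℕ → ℝ := fun n ↦ (n : ℝ) ^ (-(1 + 1 / k : ℝ))
  have hg0 (n : ℕ) : 0 ≤ g n := Real.rpow_nonneg (Nat.cast_nonneg n) _
  have hgs : Summable g := by
    refine Real.summable_nat_rpow.2 ?_
    have : (0 : ℝ) < 1 / k := by positivity
    linarith
  let A : (ι → ℕ) → Set Ω := fun φ ↦ {ω | φ.Injective ∧ (∀ v, 1 ≤ φ v) ∧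
      (Function.Injective fun e ↦ (max (φ (x e)) (φ (y e)), l e)) ∧
      ∀ e, U (max (φ (x e)) (φ (y e))) (l e) ω = min (φ (x e)) (φ (y e))}
  have hA (φ : ι → ℕ) : μ (A φ) ≤
      ENNReal.ofReal (2 ^ Fintype.card κ) * ∏ i, ENNReal.ofReal (g (φ i)) := by
    by_cases hφ : φ.Injective ∧ (∀ v, 1 ≤ φ v) ∧
        (Function.Injective fun e ↦ (max (φ (x e)) (φ (y e)), l e))
    swap
    · have : A φ = ∅ := by
        ext ω
        simp only [A, Set.mem_ofPred_eq, Set.mem_empty_iff_false, iff_false]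
        exact fun h ↦ hφ ⟨h.1, h.2.1, h.2.2.1⟩
      simp [this]
    obtain ⟨hinj, hpos, hinj'⟩ := hφ
    refine (measure_mono fun ω hω ↦ hω.2.2.2).trans ((hU.measure_forall_eq_le
      (fun e ↦ max (φ (x e)) (φ (y e))) (fun e ↦ min (φ (x e)) (φ (y e))) l
      (fun e ↦ le_min (hpos _) (hpos _)) (fun e ↦ ?_) hinj').trans ?_)
    · exact min_lt_max.2 fun h ↦ hxy e (hinj h)
    · rw [← ENNReal.ofReal_prod_of_nonneg fun _ _ ↦ hg0 _, ← ENNReal.ofReal_mul (by positivity)]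
      refine ENNReal.ofReal_le_ofReal (prod_two_div_le k hk0 φ _ hpos
        (fun e ↦ le_max_of_le_left (hpos _)) fun t ↦ ?_)
      rcases (Finset.univ.filter fun i ↦ t < φ i).eq_empty_or_nonempty with h0 | h0
      · simp [h0]
      -- The edges whose younger end exceeds `t` are those touching `S = {φ > t}`. From `|S| + 1 ≤
      -- |T|` and `|S| ≤ k` follows `(k + 1)|S| ≤ k|T|`.
      · have h1 := hcount _ h0 (Finset.univ.filter fun e ↦ t < max (φ (x e)) (φ (y e)))
          fun e ↦ by simp
        have h2 : (Finset.univ.filter fun i ↦ t < φ i).card ≤ k := Finset.card_le_univ _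
        nlinarith
  -- Borel–Cantelli: it remains to sum the probabilities over all `φ`.
  refine ae_finite_setOfPred_mem (s := A) ?_
  refine ne_top_of_le_ne_top ?_ (ENNReal.tsum_le_tsum hA)
  rw [ENNReal.tsum_mul_left]
  refine ENNReal.mul_ne_top ENNReal.ofReal_ne_top
    (ne_top_of_le_ne_top ?_ (tsum_pi_prod_le fun n ↦ ENNReal.ofReal (g n)))
  refine ENNReal.pow_ne_top ?_
  rw [← ENNReal.ofReal_tsum_of_nonneg hg0 hgs]
  exact ENNReal.ofReal_ne_top

lemma attachmentGraph_isLink_iff {f : ℕ → Fin m → ℕ} {n : ℕ∞} {e : ℕ × Fin m} {x y : ℕ} :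
    (attachmentGraph f n).IsLink e x y ↔ 2 ≤ e.1 ∧ (e.1 : ℕ∞) ≤ n ∧
      (1 ≤ f e.1 e.2 ∧ f e.1 e.2 < e.1) ∧ s(x, y) = s(e.1, f e.1 e.2) := Iff.rfl

/-- A connected multicyclic graph with all degrees at least two has almost surely only finitely many
copies in the infinite random graph. -/
lemma IsUniformAttachment.ae_finite_copies (hU : IsUniformAttachment U μ) (G : Graph α β)
    [G.Loopless] (hV : V(G).Finite) (hE : E(G).Finite)
    (hconn : ∀ S ⊆ V(G), S.Nonempty → (∀ x ∈ S, ∀ y, G.Adj x y → y ∈ S) → S = V(G))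
    (hdeg : ∀ x ∈ V(G), 2 ≤ G.deg x) (hmulti : G.IsMulticyclic) :
    ∀ᵐ ω ∂μ, (Graph.copies G (attachmentGraph (fun j a ↦ U j a ω) ⊤)).Finite := by
  classical
  have := hV.fintype
  have := hE.fintype
  have : Nonempty V(G) := hmulti.vertexSet_nonempty.to_subtype
  have hends (e : E(G)) : ∃ x y : V(G), G.IsLink e x y := by
    obtain ⟨a, b, hab⟩ := Graph.exists_isLink_of_mem_edgeSet e.2
    exact ⟨⟨a, hab.left_mem⟩, ⟨b, hab.right_mem⟩, hab⟩
  choose x y hxy using hends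
  have hcount : ∀ S : Finset V(G), S.Nonempty → ∀ T : Finset E(G),
      (∀ e, e ∈ T ↔ x e ∈ S ∨ y e ∈ S) → S.card < T.card := by
    intro S hS T hT
    have h := Graph.card_lt_card_touching hconn hdeg hmulti (S.map (Function.Embedding.subtype _))
      (by intro v hv; simp at hv; exact hv.1) (by simpa using hS)
      (T.map (Function.Embedding.subtype _)) ?_
    · simpa using h
    intro e
    simp only [Finset.mem_map, Function.Embedding.subtype_apply, Subtype.exists]
    constructor
    · rintro ⟨e, he, heT, rfl⟩
      rcases (hT _).1 heT with h | h
      · exact ⟨_, ⟨_, (x ⟨e, he⟩).2, h, rfl⟩, (hxy ⟨e, he⟩).inc_left⟩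
      · exact ⟨_, ⟨_, (y ⟨e, he⟩).2, h, rfl⟩, (hxy ⟨e, he⟩).inc_right⟩
    · rintro ⟨_, ⟨v, hv, hvS, rfl⟩, hinc⟩
      refine ⟨e, hinc.edge_mem, (hT _).2 ?_, rfl⟩
      rcases hinc.eq_or_eq_of_isLink (hxy ⟨e, hinc.edge_mem⟩) with h | h
      · left
        convert hvS
        exact h.symm
      · right
        convert hvS
        exact h.symm
  have hne (e : E(G)) : x e ≠ y e := fun h ↦ (hxy e).ne (congrArg Subtype.val h)
  have hae := ae_all_iff.2 fun l ↦ hU.ae_finite_embeddings x y hne hcount l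
  filter_upwards [hae] with ω hω
  set Γ := attachmentGraph (fun j a ↦ U j a ω) ⊤ with hΓ
  -- An edge is named by its younger end and its label, so a copy is determined by its embedding `φ`
  -- and one of the finitely many label functions `l`.
  refine (Set.finite_iUnion fun l ↦ (hω l).image fun φ ↦ (Γ.induce (Set.range φ)).restrict
    (Set.range fun e ↦ (max (φ (x e)) (φ (y e)), l e))).subset ?_
  rintro K ⟨hK, φ, ψ, hφ⟩
  have hlink (e : E(G)) : K.IsLink (ψ.symm e) (φ.symm (x e)) (φ.symm (y e)) :=
    (hφ _ _ _).2 (by simpa using hxy e)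
  have hkey (e : E(G)) : ((ψ.symm e : ℕ × Fin m).1 =
      max (φ.symm (x e) : ℕ) (φ.symm (y e))) ∧ U (ψ.symm e : ℕ × Fin m).1
        (ψ.symm e : ℕ × Fin m).2 ω = min (φ.symm (x e) : ℕ) (φ.symm (y e)) := by
    obtain ⟨h1, h2, ⟨h3, h4⟩, h5⟩ := attachmentGraph_isLink_iff.1 ((hlink e).mono hK)
    rw [Sym2.eq_iff] at h5
    rcases h5 with ⟨h5, h6⟩ | ⟨h5, h6⟩ <;> rw [h5, h6] <;> constructor
    · exact (max_eq_left h4.le).symm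
    · exact (min_eq_right h4.le).symm
    · exact (max_eq_right h4.le).symm
    · exact (min_eq_left h4.le).symm
  have hpair (e : E(G)) : (ψ.symm e : ℕ × Fin m) =
      (max (φ.symm (x e) : ℕ) (φ.symm (y e)), (ψ.symm e : ℕ × Fin m).2) :=
    Prod.ext (hkey e).1 rfl
  refine Set.mem_iUnion.2 ⟨fun e ↦ (ψ.symm e : ℕ × Fin m).2, fun v ↦ φ.symm v, ⟨?_, ?_, ?_, ?_⟩, ?_⟩
  · exact Subtype.val_injective.comp φ.symm.injective
  · exact fun v ↦ (hK.vertexSet_mono (φ.symm v).2).1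
  · simp_rw [← hpair]
    exact Subtype.val_injective.comp ψ.symm.injective
  · intro e
    have := hkey e
    rw [this.1] at this
    exact this.2
  · simp_rw [← hpair]
    have hVr : Set.range (fun v : V(G) ↦ (φ.symm v : ℕ)) = V(K) := by
      ext v
      constructor
      · rintro ⟨u, rfl⟩
        exact (φ.symm u).2
      · exact fun hv ↦ ⟨φ ⟨v, hv⟩, by simp⟩
    have hEr : Set.range (fun e : E(G) ↦ (ψ.symm e : ℕ × Fin m)) = E(K) := by
      ext e
      constructor
      · rintro ⟨u, rfl⟩
        exact (ψ.symm u).2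
      · exact fun he ↦ ⟨ψ ⟨e, he⟩, by simp⟩
    rw [hVr, hEr]
    refine Graph.Compatible.ext (by simp) ?_ (Graph.Compatible.of_le_le
      (Graph.restrict_le.trans (Graph.induce_le hK.vertexSet_mono)) hK)
    ext e
    constructor
    · exact fun h ↦ h.2
    · intro he
      obtain ⟨a, b, hab⟩ := Graph.exists_isLink_of_mem_edgeSet he
      exact ⟨⟨a, b, hab.mono hK, hab.left_mem, hab.right_mem⟩, he⟩

end Finiteness
-- Logarithmic growth of in-degrees
section LogLaw

/-- By monotone convergence the squares are almost surely summable. -/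
lemma ae_tendsto_zero_of_tsum_lintegral_sq {Ω : Type*} [MeasurableSpace Ω] {μ : Measure Ω}
    {Z : ℕ → Ω → ℝ} (hZ : ∀ k, AEMeasurable (Z k) μ)
    (h : ∑' k, ∫⁻ ω, ENNReal.ofReal (Z k ω ^ 2) ∂μ ≠ ⊤) :
    ∀ᵐ ω ∂μ, Tendsto (fun k ↦ Z k ω) atTop (𝓝 0) := by
  have hm (k : ℕ) : AEMeasurable (fun ω ↦ ENNReal.ofReal (Z k ω ^ 2)) μ :=
    ((hZ k).pow_const 2).ennreal_ofReal
  rw [← lintegral_tsum hm] at h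
  filter_upwards [ae_lt_top' (AEMeasurable.tsum hm) h] with ω hω
  have h1 := (ENNReal.tendsto_toReal ENNReal.zero_ne_top).comp
    (ENNReal.tendsto_atTop_zero_of_tsum_ne_top hω.ne)
  have h2 : Tendsto (fun k ↦ Real.sqrt (Z k ω ^ 2)) atTop (𝓝 0) := by
    rw [← Real.sqrt_zero]
    refine (Real.continuous_sqrt.tendsto 0).comp ?_
    simpa [Function.comp_def, ENNReal.toReal_ofReal, sq_nonneg] using h1
  simp_rw [Real.sqrt_sq_eq_abs] at h2
  exact (tendsto_zero_iff_abs_tendsto_zero _).2 h2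

lemma log_ceil_exp_sq_le (k : ℕ) : Real.log (⌈Real.exp ((k : ℝ) ^ 2)⌉₊ : ℝ) ≤ (k : ℝ) ^ 2 + 1 := by
  have h1 : (1 : ℝ) ≤ Real.exp ((k : ℝ) ^ 2) := Real.one_le_exp (by positivity)
  have h2 := (Nat.ceil_lt_add_one (a := Real.exp ((k : ℝ) ^ 2)) (by positivity)).le
  have h3 : (0 : ℝ) < (⌈Real.exp ((k : ℝ) ^ 2)⌉₊ : ℝ) :=
    lt_of_lt_of_le (by positivity) (Nat.le_ceil _)
  rw [Real.log_le_iff_le_exp h3, Real.exp_add]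
  have h4 : (2 : ℝ) ≤ Real.exp 1 := by linarith [Real.add_one_le_exp (1 : ℝ)]
  nlinarith

lemma le_log_ceil_exp_sq (k : ℕ) : (k : ℝ) ^ 2 ≤ Real.log (⌈Real.exp ((k : ℝ) ^ 2)⌉₊ : ℝ) := by
  rw [Real.le_log_iff_exp_le (lt_of_lt_of_le (Real.exp_pos _) (Nat.le_ceil _))]
  exact Nat.le_ceil _

lemma tendsto_div_log_of_tendsto_div_sq {S : ℕ → ℝ} (hmono : Monotone S) (h0 : ∀ n, 0 ≤ S n)
    (h : Tendsto (fun k : ℕ ↦ S ⌈Real.exp ((k : ℝ) ^ 2)⌉₊ / (k : ℝ) ^ 2) atTop (𝓝 1)) :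
    Tendsto (fun n : ℕ ↦ S n / Real.log n) atTop (𝓝 1) := by
  -- With `k = q n`, `n` lies between consecutive terms `⌈exp(k²)⌉` and `⌈exp((k + 1)²)⌉`;
  -- monotonicity suffices because `k² / (k + 1)² → 1`.
  let q : ℕ → ℕ := fun n ↦ ⌊Real.sqrt (Real.log n)⌋₊
  have hlog : Tendsto (fun n : ℕ ↦ Real.log n) atTop atTop :=
    Real.tendsto_log_atTop.comp tendsto_natCast_atTop_atTop
  have hq : Tendsto q atTop atTop :=
    tendsto_nat_floor_atTop.comp (Real.tendsto_sqrt_atTop.comp hlog)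
  have hr : Tendsto (fun k : ℕ ↦ ((k : ℝ) / ((k : ℝ) + 1)) ^ 2) atTop (𝓝 1) := by
    have := (tendsto_natCast_div_add_atTop (1 : ℝ)).pow 2
    simpa using this
  have hlow : Tendsto (fun k : ℕ ↦ S ⌈Real.exp ((k : ℝ) ^ 2)⌉₊ / ((k : ℝ) + 1) ^ 2)
      atTop (𝓝 1) := by
    have := h.mul hr
    rw [one_mul] at this
    refine this.congr' ?_
    filter_upwards [eventually_gt_atTop 0] with k hk
    have : (0 : ℝ) < k := by exact_mod_cast hk
    field_simp
  have hup : Tendsto (fun k : ℕ ↦ S ⌈Real.exp (((k + 1 : ℕ) : ℝ) ^ 2)⌉₊ / (k : ℝ) ^ 2)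
      atTop (𝓝 1) := by
    have h1 := ((tendsto_add_atTop_iff_nat 1).2 h).div hr one_ne_zero
    rw [div_one] at h1
    refine h1.congr' ?_
    filter_upwards [eventually_gt_atTop 0] with k hk
    have : (0 : ℝ) < k := by exact_mod_cast hk
    simp only [Pi.div_apply]
    push_cast
    field_simp
  refine tendsto_of_tendsto_of_tendsto_of_le_of_le' (hlow.comp hq) (hup.comp hq) ?_ ?_
  · filter_upwards [hlog.eventually_gt_atTop 0, eventually_gt_atTop 0] with n hn hn0
    have hn0' : (0 : ℝ) < n := by exact_mod_cast hn0
    have h1 : (q n : ℝ) ≤ Real.sqrt (Real.log n) := Nat.floor_le (Real.sqrt_nonneg _)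
    have h2 : Real.sqrt (Real.log n) < q n + 1 := Nat.lt_floor_add_one _
    have h3 := Real.sq_sqrt hn.le
    have h4 := Real.sqrt_nonneg (Real.log n)
    refine div_le_div₀ (h0 n) (hmono ?_) hn (by nlinarith)
    rw [Nat.ceil_le, ← Real.le_log_iff_exp_le hn0', ← h3]
    exact pow_le_pow_left₀ (Nat.cast_nonneg _) h1 2
  · filter_upwards [hlog.eventually_gt_atTop 0, eventually_gt_atTop 0,
      hq.eventually_gt_atTop 0] with n hn hn0 hqn
    have hn0' : (0 : ℝ) < n := by exact_mod_cast hn0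
    have hqn' : (0 : ℝ) < q n := by exact_mod_cast hqn
    have h1 : (q n : ℝ) ≤ Real.sqrt (Real.log n) := Nat.floor_le (Real.sqrt_nonneg _)
    have h2 : Real.sqrt (Real.log n) < q n + 1 := Nat.lt_floor_add_one _
    have h3 := Real.sq_sqrt hn.le
    have h4 := Real.sqrt_nonneg (Real.log n)
    refine div_le_div₀ (h0 _) (hmono ?_) (by positivity) (by nlinarith)
    have h5 : (n : ℝ) ≤ Real.exp (((q n + 1 : ℕ) : ℝ) ^ 2) := by
      rw [← Real.log_le_iff_le_exp hn0', ← h3]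
      refine pow_le_pow_left₀ h4 ?_ 2
      push_cast
      exact h2.le
    exact_mod_cast h5.trans (Nat.le_ceil _)

lemma harmonic_cast_eq_sum_Ioc (n : ℕ) :
    ((harmonic n : ℚ) : ℝ) = ∑ j ∈ Finset.Ioc 0 n, 1 / (j : ℝ) := by
  induction n with
  | zero => simp
  | succ n ih =>
    rw [harmonic_succ, Finset.sum_Ioc_succ_top (Nat.zero_le n)]
    push_cast at ih ⊢
    rw [ih, one_div]

lemma sum_Ioc_one_div_pred_le {v n : ℕ} (hv : 1 ≤ v) :
    ∑ j ∈ Finset.Ioc v n, 1 / ((j - 1 : ℕ) : ℝ) ≤ 1 + Real.log n := by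
  refine le_trans ?_ (harmonic_le_one_add_log n)
  rw [harmonic_cast_eq_sum_Ioc]
  have h1 : ∑ j ∈ Finset.Ioc v n, 1 / ((j - 1 : ℕ) : ℝ) = ∑ i ∈ (Finset.Ioc v n).image (fun i : ℕ ↦ i - 1),
      1 / (i : ℝ) := by
    rw [Finset.sum_image]
    intro i hi j hj hij
    simp only [Finset.coe_Ioc, Set.mem_Ioc] at hi hj hij
    omega
  rw [h1]
  refine Finset.sum_le_sum_of_subset_of_nonneg ?_ fun _ _ _ ↦ by positivity
  intro i hi
  simp only [Finset.mem_image, Finset.mem_Ioc] at hi ⊢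
  omega

lemma log_sub_harmonic_le_sum_Ioc {v n : ℕ} (hv : 1 ≤ v) (hn : 1 ≤ n) :
    Real.log n - harmonic v ≤ ∑ j ∈ Finset.Ioc v n, 1 / ((j - 1 : ℕ) : ℝ) := by
  have h1 : Real.log n ≤ harmonic n := by
    refine le_trans (Real.log_le_log (by exact_mod_cast hn) ?_) (log_add_one_le_harmonic n)
    push_cast
    linarith
  have h2 : ((harmonic n : ℚ) : ℝ) ≤ harmonic v + ∑ j ∈ Finset.Ioc v n, 1 / (j : ℝ) := by
    rw [harmonic_cast_eq_sum_Ioc, harmonic_cast_eq_sum_Ioc, ← Finset.sum_union]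
    · refine Finset.sum_le_sum_of_subset_of_nonneg ?_ fun _ _ _ ↦ by positivity
      intro i hi
      simp only [Finset.mem_union, Finset.mem_Ioc] at hi ⊢
      omega
    · rw [Finset.disjoint_left]
      intro i hi hi'
      simp only [Finset.mem_Ioc] at hi hi'
      omega
  have h3 : ∑ j ∈ Finset.Ioc v n, 1 / (j : ℝ) ≤ ∑ j ∈ Finset.Ioc v n, 1 / ((j - 1 : ℕ) : ℝ) := by
    refine Finset.sum_le_sum fun j hj ↦ ?_
    rw [Finset.mem_Ioc] at hj
    have : (0 : ℝ) < ((j - 1 : ℕ) : ℝ) := by exact_mod_cast (by omega : 0 < j - 1)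
    exact one_div_le_one_div_of_le this (by exact_mod_cast Nat.sub_le j 1)
  linarith

variable {Ω : Type*} [MeasurableSpace Ω] {μ : Measure Ω} [IsProbabilityMeasure μ] {m : ℕ}
  {U : ℕ → Fin m → Ω → ℕ}

/-- The left side is the variance of a sum of pairwise independent indicators, each with variance at
most its mean. -/
lemma IsUniformAttachment.lintegral_sq_sub_le (hU : IsUniformAttachment U μ) {v : ℕ} (hv : 1 ≤ v)
    (a : Fin m) (n : ℕ) :
    ∫⁻ ω, ENNReal.ofReal ((∑ j ∈ Finset.Ioc v n, (if U j a ω = v then (1 : ℝ) else 0)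
      - ∑ j ∈ Finset.Ioc v n, 1 / ((j - 1 : ℕ) : ℝ)) ^ 2) ∂μ ≤
      ENNReal.ofReal (∑ j ∈ Finset.Ioc v n, 1 / ((j - 1 : ℕ) : ℝ)) := by
  let g : ℕ → ℝ := fun i ↦ if i = v then 1 else 0
  let X : ℕ → Ω → ℝ := fun j ω ↦ g (U j a ω)
  have hg : Measurable g := .of_discrete
  have hj {j : ℕ} (hj : j ∈ Finset.Ioc v n) : 2 ≤ j := by
    rw [Finset.mem_Ioc] at hj
    omega
  have hX {j : ℕ} (h : j ∈ Finset.Ioc v n) : Measurable (X j) := hg.comp (hU.measurable j (hj h) a)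
  have hL {j : ℕ} (h : j ∈ Finset.Ioc v n) : MemLp (X j) 2 μ := by
    refine MemLp.of_bound (hX h).aestronglyMeasurable 1 (ae_of_all _ fun ω ↦ ?_)
    simp only [X, g]
    split_ifs <;> simp
  have hint {j : ℕ} (h : j ∈ Finset.Ioc v n) : ∫ ω, X j ω ∂μ = 1 / ((j - 1 : ℕ) : ℝ) := by
    have h1 : X j = Set.indicator {ω | U j a ω = v} 1 := by
      ext ω
      simp [X, g, Set.indicator_apply]
    have h2 : MeasurableSet {ω | U j a ω = v} :=
      hU.measurable j (hj h) a (MeasurableSet.of_discrete (s := {v}))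
    rw [h1, integral_indicator_one h2, Measure.real,
      hU.uniform j (hj h) a v hv (Finset.mem_Ioc.1 h).1, one_div, ENNReal.toReal_inv,
      ENNReal.toReal_natCast, one_div]
  have hvar {j : ℕ} (h : j ∈ Finset.Ioc v n) : variance (X j) μ ≤ 1 / ((j - 1 : ℕ) : ℝ) := by
    refine (variance_le_expectation_sq (hX h).aestronglyMeasurable).trans (le_of_eq ?_)
    rw [← hint h]
    congr 1 with ω
    simp only [X, g, Pi.pow_apply]
    split_ifs <;> simp
  have hindep : Set.Pairwise (Finset.Ioc v n : Set ℕ) fun i j ↦ IndepFun (X i) (X j) μ := by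
    intro i hi j hj' hij
    have h1 := hU.indep.indepFun (i := (⟨i, hj hi⟩, a)) (j := (⟨j, hj hj'⟩, a)) (by simpa using hij)
    exact h1.comp hg hg
  have hsum := IndepFun.variance_sum (fun i hi ↦ hL hi) hindep
  have hmean : μ[∑ j ∈ Finset.Ioc v n, X j] = ∑ j ∈ Finset.Ioc v n, 1 / ((j - 1 : ℕ) : ℝ) := by
    simp only [Finset.sum_apply]
    rw [integral_finsetSum _ fun j h ↦ (hL h).integrable (by norm_num)]
    exact Finset.sum_congr rfl fun j h ↦ hint h
  have hLS : MemLp (∑ j ∈ Finset.Ioc v n, X j) 2 μ := memLp_finsetSum' _ fun j h ↦ hL h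
  have h1 := ofReal_variance hLS
  rw [evariance_eq_lintegral_ofReal, hmean] at h1
  simp only [Finset.sum_apply] at h1
  refine h1.symm.le.trans (ENNReal.ofReal_le_ofReal ?_)
  rw [hsum]
  exact Finset.sum_le_sum fun j h ↦ hvar h

/-- The in-degree of a vertex grows almost surely logarithmically. -/
lemma IsUniformAttachment.ae_tendsto_card_div_log (hU : IsUniformAttachment U μ) {v : ℕ}
    (hv : 1 ≤ v) (a : Fin m) :
    ∀ᵐ ω ∂μ, Tendsto (fun n : ℕ ↦ (((Finset.Ioc v n).filter fun j ↦ U j a ω = v).card : ℝ) /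
      Real.log n) atTop (𝓝 1) := by
  let S : ℕ → Ω → ℝ := fun n ω ↦ ∑ j ∈ Finset.Ioc v n, (if U j a ω = v then (1 : ℝ) else 0)
  let h : ℕ → ℝ := fun n ↦ ∑ j ∈ Finset.Ioc v n, 1 / ((j - 1 : ℕ) : ℝ)
  -- Sparse enough that the normalised variances, of order `k² / k⁴`, are summable; dense enough
  -- that `log (N (k + 1)) / log (N k) → 1`.
  let N : ℕ → ℕ := fun k ↦ ⌈Real.exp ((k : ℝ) ^ 2)⌉₊
  have hN (k : ℕ) : 1 ≤ N k := Nat.one_le_ceil_iff.2 (Real.exp_pos _)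
  have hup (k : ℕ) : h (N k) ≤ (k : ℝ) ^ 2 + 2 := by
    have h1 := sum_Ioc_one_div_pred_le (n := N k) hv
    have h2 := log_ceil_exp_sq_le k
    simp only [h, N] at h1 ⊢
    linarith
  have hlow (k : ℕ) : (k : ℝ) ^ 2 - harmonic v ≤ h (N k) := by
    have h1 := log_sub_harmonic_le_sum_Ioc hv (hN k)
    have h2 := le_log_ceil_exp_sq k
    simp only [h, N] at h1 ⊢
    linarith
  have hmeas (n : ℕ) : Measurable (S n) := by
    refine Finset.measurable_sum _ fun j hj ↦ ?_
    rw [Finset.mem_Ioc] at hj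
    exact (Measurable.of_discrete (f := fun i : ℕ ↦ if i = v then (1 : ℝ) else 0)).comp
      (hU.measurable j (by omega) a)
  have hk2 : Tendsto (fun k : ℕ ↦ (k : ℝ) ^ 2) atTop atTop :=
    (tendsto_pow_atTop two_ne_zero).comp tendsto_natCast_atTop_atTop
  have hratio : Tendsto (fun k : ℕ ↦ h (N k) / (k : ℝ) ^ 2) atTop (𝓝 1) := by
    have h1 : Tendsto (fun k : ℕ ↦ 1 - (harmonic v : ℝ) / (k : ℝ) ^ 2) atTop (𝓝 1) := by
      simpa using tendsto_const_nhds.sub (hk2.const_div_atTop (harmonic v : ℝ))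
    have h2 : Tendsto (fun k : ℕ ↦ 1 + 2 / (k : ℝ) ^ 2) atTop (𝓝 1) := by
      simpa using tendsto_const_nhds.add (hk2.const_div_atTop (2 : ℝ))
    refine tendsto_of_tendsto_of_tendsto_of_le_of_le' h1 h2 ?_ ?_
    · filter_upwards [eventually_gt_atTop 0] with k hk
      have : (0 : ℝ) < k := by exact_mod_cast hk
      rw [le_div_iff₀ (by positivity), sub_mul, div_mul_cancel₀ _ (by positivity), one_mul]
      exact hlow k
    · filter_upwards [eventually_gt_atTop 0] with k hk
      have : (0 : ℝ) < k := by exact_mod_cast hk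
      rw [div_le_iff₀ (by positivity), add_mul, div_mul_cancel₀ _ (by positivity), one_mul]
      exact hup k
  have hZ : ∀ᵐ ω ∂μ, Tendsto (fun k : ℕ ↦ (S (N k) ω - h (N k)) / (k : ℝ) ^ 2) atTop (𝓝 0) := by
    refine ae_tendsto_zero_of_tsum_lintegral_sq
      (fun k ↦ (((hmeas _).sub_const _).div_const _).aemeasurable) ?_
    have hbd (k : ℕ) : ∫⁻ ω, ENNReal.ofReal (((S (N k) ω - h (N k)) / (k : ℝ) ^ 2) ^ 2) ∂μ ≤
        ENNReal.ofReal (3 * (1 / (k : ℝ) ^ 2)) := by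
      -- At `k = 0` division by zero makes both sides 0.
      rcases Nat.eq_zero_or_pos k with rfl | hk
      · simp
      have hk' : (1 : ℝ) ≤ k := by exact_mod_cast hk
      have heq (ω : Ω) : ENNReal.ofReal (((S (N k) ω - h (N k)) / (k : ℝ) ^ 2) ^ 2) =
          ENNReal.ofReal (1 / (k : ℝ) ^ 4) * ENNReal.ofReal ((S (N k) ω - h (N k)) ^ 2) := by
        rw [← ENNReal.ofReal_mul (by positivity)]
        congr 1
        field_simp
      simp_rw [heq]
      rw [lintegral_const_mul' _ _ ENNReal.ofReal_ne_top]
      refine (mul_le_mul_right (hU.lintegral_sq_sub_le hv a (N k)) _).trans ?_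
      rw [← ENNReal.ofReal_mul (by positivity)]
      refine ENNReal.ofReal_le_ofReal ?_
      have h1 : h (N k) ≤ 3 * (k : ℝ) ^ 2 := by nlinarith [hup k]
      calc 1 / (k : ℝ) ^ 4 * h (N k) ≤ 1 / (k : ℝ) ^ 4 * (3 * (k : ℝ) ^ 2) := by gcongr
        _ = 3 * (1 / (k : ℝ) ^ 2) := by field_simp
    refine ne_top_of_le_ne_top ?_ (ENNReal.tsum_le_tsum hbd)
    rw [← ENNReal.ofReal_tsum_of_nonneg (fun k ↦ by positivity)
      ((Real.summable_one_div_nat_pow.2 one_lt_two).mul_left 3)]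
    exact ENNReal.ofReal_ne_top
  filter_upwards [hZ] with ω hω
  have hS (n : ℕ) : (((Finset.Ioc v n).filter fun j ↦ U j a ω = v).card : ℝ) = S n ω := by
    simp [S]
  simp_rw [hS]
  refine tendsto_div_log_of_tendsto_div_sq (S := fun n ↦ S n ω) ?_ ?_ ?_
  · intro i j hij
    refine Finset.sum_le_sum_of_subset_of_nonneg (Finset.Ioc_subset_Ioc_right hij) fun _ _ _ ↦ ?_
    split_ifs <;> norm_num
  · exact fun n ↦ Finset.sum_nonneg fun _ _ ↦ by split_ifs <;> norm_num
  · have := hω.add hratio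
    rw [zero_add] at this
    refine this.congr fun k ↦ ?_
    rw [← add_div, sub_add_cancel]

end LogLaw
-- From copies of `H'` and in-degrees to copies of `H`
section Asymptotics

variable {α β : Type*} {m : ℕ} {f : ℕ → Fin m → ℕ}

lemma attachmentGraph_mono {n n' : ℕ∞} (h : n ≤ n') : attachmentGraph f n ≤ attachmentGraph f n' :=
  ⟨fun _ hx ↦ ⟨hx.1, hx.2.trans h⟩, fun _ _ _ hl ↦ ⟨hl.1, hl.2.1.trans h, hl.2.2⟩⟩

lemma finite_edgeSet_attachmentGraph (n : ℕ) : E(attachmentGraph f n).Finite := by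
  refine ((Set.finite_Iic n).prod (Set.finite_univ (α := Fin m))).subset ?_
  rintro e ⟨x, y, h⟩
  exact ⟨by exact_mod_cast h.2.1, trivial⟩

lemma exists_le_attachmentGraph {K : Graph ℕ (ℕ × Fin m)} (hK : K ≤ attachmentGraph f ⊤)
    (hV : V(K).Finite) : ∃ n₀ : ℕ, ∀ n : ℕ, n₀ ≤ n → K ≤ attachmentGraph f n := by
  obtain ⟨n₀, hn₀⟩ := hV.bddAbove
  refine ⟨n₀, fun n hn ↦ ⟨fun x hx ↦ ⟨(hK.vertexSet_mono hx).1, ?_⟩, fun e x y hxy ↦ ?_⟩⟩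
  · exact_mod_cast (hn₀ hx).trans hn
  · obtain ⟨h1, h2, h3, h4⟩ := attachmentGraph_isLink_iff.1 (hxy.mono hK)
    refine ⟨h1, ?_, h3, h4⟩
    -- The first coordinate of an edge's name is its younger end, so a bound on the vertices of `K`
    -- also bounds its edges.
    have hmem : e.1 ∈ V(K) := by
      rw [Sym2.eq_iff] at h4
      rcases h4 with ⟨h, -⟩ | ⟨-, h⟩
      · exact h ▸ hxy.left_mem
      · exact h ▸ hxy.right_mem
    exact_mod_cast (hn₀ hmem).trans hn

lemma eventually_copies_eq {G : Graph α β} (hV : V(G).Finite)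
    (hfin : (Graph.copies G (attachmentGraph f ⊤)).Finite) :
    ∀ᶠ n : ℕ in atTop,
      Graph.copies G (attachmentGraph f n) = Graph.copies G (attachmentGraph f ⊤) := by
  have h : ∀ K ∈ Graph.copies G (attachmentGraph f ⊤),
      ∀ᶠ n : ℕ in atTop, K ≤ attachmentGraph f n := by
    rintro K ⟨hK, φ, -⟩
    have : Finite V(G) := hV
    have : Finite V(K) := Finite.of_equiv _ φ.symm
    obtain ⟨n₀, hn₀⟩ := exists_le_attachmentGraph hK (Set.toFinite _)
    exact eventually_atTop.2 ⟨n₀, hn₀⟩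
  filter_upwards [(eventually_all_finite hfin).2 h] with n hn
  ext K
  exact ⟨fun hK ↦ ⟨hK.1.trans (attachmentGraph_mono le_top), hK.2⟩, fun hK ↦ ⟨hn K hK, hK.2⟩⟩

/-- The edges of the attachment graph whose older end vertex is in `A`. -/
def edgesInto (f : ℕ → Fin m → ℕ) (A : Finset ℕ) (n : ℕ) : Finset (ℕ × Fin m) :=
  (Finset.range (n + 1) ×ˢ Finset.univ).filter fun e ↦ f e.1 e.2 ∈ A ∧ f e.1 e.2 < e.1

lemma mem_edgesInto {A : Finset ℕ} {n : ℕ} {e : ℕ × Fin m} :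
    e ∈ edgesInto f A n ↔ e.1 ≤ n ∧ f e.1 e.2 ∈ A ∧ f e.1 e.2 < e.1 := by
  simp [edgesInto]

lemma card_edgesInto (A : Finset ℕ) (n : ℕ) :
    (edgesInto f A n).card = ∑ p ∈ A ×ˢ (Finset.univ : Finset (Fin m)),
      ((Finset.Ioc p.1 n).filter fun j ↦ f j p.2 = p.1).card := by
  rw [Finset.card_eq_sum_card_fiberwise (t := A ×ˢ (Finset.univ : Finset (Fin m)))
    (f := fun e ↦ (f e.1 e.2, e.2))]
  · refine Finset.sum_congr rfl fun p hp ↦ ?_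
    have hpA : p.1 ∈ A := (Finset.mem_product.1 hp).1
    rw [← Finset.card_image_of_injective ((Finset.Ioc p.1 n).filter fun j ↦ f j p.2 = p.1)
      (f := fun j ↦ (j, p.2)) fun i j h ↦ congrArg Prod.fst h]
    refine congrArg Finset.card ?_
    ext ⟨j, a⟩
    obtain ⟨v, b⟩ := p
    simp only [Finset.mem_filter, mem_edgesInto, Finset.mem_image, Finset.mem_Ioc, Prod.mk.injEq]
    constructor
    · rintro ⟨⟨h1, h2, h3⟩, rfl, rfl⟩
      exact ⟨j, ⟨⟨h3, h1⟩, rfl⟩, rfl, rfl⟩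
    · rintro ⟨i, ⟨⟨h1, h2⟩, h3⟩, rfl, rfl⟩
      subst h3
      exact ⟨⟨h2, hpA, h1⟩, rfl, rfl⟩
  · intro e he
    simpa using (mem_edgesInto.1 he).2.1

lemma tendsto_card_edgesInto_div_log
    (hlog : ∀ v, 1 ≤ v → ∀ a, Tendsto (fun n : ℕ ↦
      (((Finset.Ioc v n).filter fun j ↦ f j a = v).card : ℝ) / Real.log n) atTop (𝓝 1))
    (A : Finset ℕ) (hA : ∀ v ∈ A, 1 ≤ v) :
    Tendsto (fun n : ℕ ↦ ((edgesInto f A n).card : ℝ) / Real.log n) atTop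
      (𝓝 ((A.card * m : ℕ) : ℝ)) := by
  have h := tendsto_finsetSum (A ×ˢ (Finset.univ : Finset (Fin m)))
    fun p hp ↦ hlog p.1 (hA p.1 (Finset.mem_product.1 hp).1) p.2
  simp only [Finset.sum_const, Finset.card_product, Finset.card_univ, Fintype.card_fin,
    nsmul_eq_mul, mul_one] at h
  refine h.congr fun n ↦ ?_
  rw [card_edgesInto, Nat.cast_sum, Finset.sum_div]

/-- Unless an edge is born at a vertex of `K`, it extends `K` to `H` exactly when its older end is
one of the admissible vertices `A`. The exceptional edges lie in a finite set independent of `n`,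
negligible against `log n`. -/
lemma tendsto_ncard_leafEdges_div_log {α' β' : Type*}
    (hlog : ∀ v, 1 ≤ v → ∀ a, Tendsto (fun n : ℕ ↦
      (((Finset.Ioc v n).filter fun j ↦ f j a = v).card : ℝ) / Real.log n) atTop (𝓝 1))
    (H : Graph α' β') {K : Graph ℕ (ℕ × Fin m)} (hK : K ≤ attachmentGraph f ⊤)
    (hV : V(K).Finite) :
    Tendsto (fun n : ℕ ↦ ((Graph.leafEdges H K (attachmentGraph f n)).ncard : ℝ) / Real.log n)
      atTop (𝓝 ((Graph.attachCount K H * m : ℕ) : ℝ)) := by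
  classical
  have hpos : ∀ v ∈ V(K), 1 ≤ v := fun v hv ↦ (hK.vertexSet_mono hv).1
  have hAfin : {v : V(K) | Graph.IsIso (K.attachEdge v) H}.Finite := by
    have : Finite V(K) := hV
    exact Set.toFinite _
  let A : Finset ℕ := hAfin.toFinset.map (Function.Embedding.subtype _)
  have hA (v : ℕ) : v ∈ A ↔ ∃ hv : v ∈ V(K), Graph.IsIso (K.attachEdge ⟨v, hv⟩) H := by
    simp [A]
  have hAcard : A.card = Graph.attachCount K H := by
    rw [Finset.card_map, Graph.attachCount, Set.ncard_eq_toFinset_card _ hAfin]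
  have hmain := tendsto_card_edgesInto_div_log hlog A fun v hv ↦ hpos v ((hA v).1 hv).1
  rw [hAcard] at hmain
  let F : Finset (ℕ × Fin m) := hV.toFinset ×ˢ Finset.univ
  have hF (e : ℕ × Fin m) : e ∈ F ↔ e.1 ∈ V(K) := by simp [F]
  have hfin (n : ℕ) : (Graph.leafEdges H K (attachmentGraph f n)).Finite :=
    (finite_edgeSet_attachmentGraph n).subset fun e ⟨_, _, _, _, hl, _⟩ ↦ hl.edge_mem
  have hdiff (n : ℕ) (e : ℕ × Fin m) (he : e ∉ F) :
      e ∈ Graph.leafEdges H K (attachmentGraph f n) ↔ e ∈ edgesInto f A n := by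
    rw [hF] at he
    rw [mem_edgesInto]
    constructor
    · rintro ⟨v, hv, w, hw, ⟨-, h2, h3, h4⟩, hiso⟩
      rw [Sym2.eq_iff] at h4
      rcases h4 with ⟨rfl, -⟩ | ⟨rfl, -⟩
      · exact absurd hv he
      · exact ⟨by exact_mod_cast h2, (hA _).2 ⟨hv, hiso⟩, h3.2⟩
    · rintro ⟨h1, h2, h3⟩
      obtain ⟨hv, hiso⟩ := (hA _).1 h2
      have := hpos _ hv
      exact ⟨f e.1 e.2, hv, e.1, he, ⟨by omega, by exact_mod_cast h1, ⟨this, h3⟩, Sym2.eq_swap⟩,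
        hiso⟩
  have hle1 (n : ℕ) : (Graph.leafEdges H K (attachmentGraph f n)).ncard ≤
      (edgesInto f A n).card + F.card := by
    rw [Set.ncard_eq_toFinset_card _ (hfin n)]
    refine le_trans (Finset.card_le_card ?_) (Finset.card_union_le _ _)
    intro e he
    rw [Set.Finite.mem_toFinset] at he
    by_cases heF : e ∈ F
    · exact Finset.mem_union_right _ heF
    · exact Finset.mem_union_left _ ((hdiff n e heF).1 he)
  have hle2 (n : ℕ) : (edgesInto f A n).card ≤
      (Graph.leafEdges H K (attachmentGraph f n)).ncard + F.card := by
    rw [Set.ncard_eq_toFinset_card _ (hfin n)]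
    refine le_trans (Finset.card_le_card ?_) (Finset.card_union_le _ _)
    intro e he
    by_cases heF : e ∈ F
    · exact Finset.mem_union_right _ heF
    · exact Finset.mem_union_left _ ((Set.Finite.mem_toFinset _).2 ((hdiff n e heF).2 he))
  have hlogtop : Tendsto (fun n : ℕ ↦ Real.log n) atTop atTop :=
    Real.tendsto_log_atTop.comp tendsto_natCast_atTop_atTop
  have hconst := hlogtop.const_div_atTop (F.card : ℝ)
  refine tendsto_of_tendsto_of_tendsto_of_le_of_le' (by simpa using hmain.sub hconst)
    (by simpa using hmain.add hconst) ?_ ?_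
  · filter_upwards [hlogtop.eventually_gt_atTop 0] with n hn
    rw [← sub_div]
    refine div_le_div_of_nonneg_right ?_ hn.le
    have : ((edgesInto f A n).card : ℝ) ≤
      (Graph.leafEdges H K (attachmentGraph f n)).ncard + F.card := by exact_mod_cast hle2 n
    linarith
  · filter_upwards [hlogtop.eventually_gt_atTop 0] with n hn
    rw [← add_div]
    refine div_le_div_of_nonneg_right ?_ hn.le
    exact_mod_cast hle1 n

/-- If `H'` has finitely many copies and all in-degrees grow like `log n`, then the number of copies
of a graph `H` obtained from `H'` by attaching an edge grows like `log n`. -/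
lemma tendsto_ncard_copies_div_log {H' H : Graph α β} {e₀ : β} {v₀ w₀ : α}
    (h : Graph.IsLeafExt H' H e₀ v₀ w₀) (hdeg : ∀ x ∈ V(H'), 2 ≤ H'.deg x) (hV : V(H').Finite)
    (hfin : (Graph.copies H' (attachmentGraph f ⊤)).Finite)
    (hlog : ∀ v, 1 ≤ v → ∀ a, Tendsto (fun n : ℕ ↦
      (((Finset.Ioc v n).filter fun j ↦ f j a = v).card : ℝ) / Real.log n) atTop (𝓝 1)) :
    Tendsto (fun n : ℕ ↦ ((Graph.copies H (attachmentGraph f n)).ncard : ℝ) / Real.log n) atTop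
      (𝓝 ((Graph.attachCount H' H * m : ℕ) *
        ((Graph.copies H' (attachmentGraph f ⊤)).ncard : ℝ))) := by
  have h1 := tendsto_finsetSum hfin.toFinset fun K hK ↦ by
    obtain ⟨hle, hiso⟩ := (Set.Finite.mem_toFinset _).1 hK
    have hVK : V(K).Finite := by
      obtain ⟨φ, -⟩ := hiso
      have : Finite V(H') := hV
      exact Finite.of_equiv _ φ.symm
    have := tendsto_ncard_leafEdges_div_log hlog H hle hVK
    rwa [Graph.attachCount_congr hiso] at this
  rw [Finset.sum_const, nsmul_eq_mul, ← Set.ncard_eq_toFinset_card _ hfin, mul_comm] at h1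
  refine h1.congr' ?_
  filter_upwards [eventually_copies_eq hV hfin] with n hn
  have hfin' : (Graph.copies H' (attachmentGraph f n)).Finite := hn ▸ hfin
  rw [Graph.ncard_copies_eq_sum h hdeg (finite_edgeSet_attachmentGraph n) hfin', Nat.cast_sum,
    Finset.sum_div]
  exact Finset.sum_congr (by ext K; simp [hn]) fun _ _ ↦ rfl

end Asymptotics

theorem theorem3p8 {α β Ω : Type*} [MeasurableSpace Ω] (μ : Measure Ω) [IsProbabilityMeasure μ]
    (m : ℕ) (hm : 1 ≤ m) (U : ℕ → Fin m → Ω → ℕ) (hU : IsUniformAttachment U μ)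
    (H H' : Graph α β) (hloop : H.Loopless) (hV : V(H).Finite) (hE : E(H).Finite)
    (hconn : H.IsConnected) (hmulti : H.IsMulticyclic) (hcore : Graph.IsTwoCore H' H)
    (ht : (V(H) \ V(H')).ncard = 1) :
    0 < Graph.attachCount H' H * m ∧
    ∀ᵐ ω ∂μ,
      (Graph.copies H' (attachmentGraph (fun j a ↦ U j a ω) ⊤)).Finite ∧
      Tendsto (fun n : ℕ ↦ (copyCount H U n ω : ℝ) / Real.log n
        - (Graph.attachCount H' H * m : ℕ) * (copyCount H' U n ω : ℝ)) atTop (𝓝 0) ∧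
      Tendsto (fun n : ℕ ↦ (copyCount H U n ω : ℝ) / Real.log n) atTop
        (𝓝 ((Graph.attachCount H' H * m : ℕ) * (copyCount H' U ⊤ ω : ℝ))) := by
  obtain ⟨e, v, w, hext⟩ := hcore.exists_isLeafExt hconn hmulti ht
  have hle : H' ≤ H := hext.le
  have hdeg : ∀ x ∈ V(H'), 2 ≤ H'.deg x := hcore.1.2
  have hV' : V(H').Finite := hV.subset hle.vertexSet_mono
  have hE' : E(H').Finite := hE.subset hle.edgeSet_mono
  have : H'.Loopless := Graph.Loopless.anti hle
  constructor
  · refine Nat.mul_pos ?_ hm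
    have : Finite V(H') := hV'
    rw [Graph.attachCount, Set.ncard_pos]
    exact ⟨⟨v, hext.left_mem⟩, hext.isIso⟩
  have hlog : ∀ᵐ ω ∂μ, ∀ v : ℕ, ∀ a : Fin m, 1 ≤ v → Tendsto (fun n : ℕ ↦
      (((Finset.Ioc v n).filter fun j ↦ U j a ω = v).card : ℝ) / Real.log n) atTop (𝓝 1) := by
    refine ae_all_iff.2 fun v ↦ ae_all_iff.2 fun a ↦ ?_
    by_cases hv : 1 ≤ v
    · filter_upwards [hU.ae_tendsto_card_div_log hv a] with ω hω _ using hω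
    · exact ae_of_all _ fun ω h ↦ absurd h hv
  filter_upwards [hlog, hU.ae_finite_copies H' hV' hE'
    (fun S hS hne hadj ↦ hext.eq_vertexSet_of_adj_closed hconn hS hne hadj) hdeg
    (hcore.isMulticyclic hmulti)] with ω hω hfin
  have hlim := tendsto_ncard_copies_div_log hext hdeg hV' hfin fun v hv a ↦ hω v a hv
  refine ⟨hfin, ?_, hlim⟩
  -- The copy count of `H'` is eventually constant, so the difference tends to a limit minus itself.
  rw [← sub_self ((Graph.attachCount H' H * m : ℕ) *
    ((Graph.copies H' (attachmentGraph (fun j a ↦ U j a ω) ⊤)).ncard : ℝ))]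
  refine hlim.sub (tendsto_const_nhds.congr' ?_)
  filter_upwards [eventually_copies_eq hV' hfin] with n hn
  rw [copyCount, hn]
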